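/- Let $b>0$, $\alpha>-1$ and $0<r_1<r_2<b^{-\frac{1}{2b}}$ be fixed. For $n\in\mathbb{N}_{>0}$ let $Q(z)=|z|^{2b}-\frac{2\alpha}{n}\log|z|$ if $|z|\notin(r_1,r_2)$ and $Q(z)=+\infty$ if $|z|\in(r_1,r_2)$, and let $$K_n(z,w)=e^{-\frac n2 Q(z)}e^{-\frac n2 Q(w)}\sum_{j=1}^{n}\frac{z^{j-1}\overline{w}^{\,j-1}}{h_j},\qquad h_j=\int_{\mathbb{C}}|z|^{2j-2}e^{-nQ(z)}\frac{d^2z}{\pi},$$ be the canonical correlation kernel of the associated determinantal point process (the reproducing kernel of the space of weighted polynomials $p(z)e^{-nQ(z)/2}$, $\deg p\le n-1$, in $L^2(\mathbb{C},d^2z/\pi)$). Write $\tilde\Delta Q(r_1)=\lim_{r\uparrow r_1}\Delta Q(r)=b^2r_1^{2b-2}$, where $\Delta Q=\frac14(Q_{xx}+Q_{yy})$, and $\mathrm{erfc}(y)=\frac{2}{\sqrt\pi}\int_y^\infty e^{-t^2}dt$. Let $\mathfrak{s}_1,\mathfrak{s}_2>0$ and $\beta\in\mathbb{R}$ be fixed,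 and let $$z=r_1\Big(1-\frac{\mathfrak{s}_1}{br_1^b\sqrt{2n}}\Big)e^{i\beta},\qquad w=r_1\Big(1-\frac{\mathfrak{s}_2}{br_1^b\sqrt{2n}}\Big)e^{i\beta}.$$ Then, as $n\to+\infty$, $$K_n(z,w)=C_1 n+C_2\sqrt n+\mathcal{O}(1),$$ where $$C_1=2\tilde\Delta Q(r_1)\int_{-\infty}^{+\infty}\frac{e^{-\frac{(y+\mathfrak{s}_1)^2+(y+\mathfrak{s}_2)^2}{2}}}{\sqrt\pi\,\mathrm{erfc}(y)}\,dy,$$ $$C_2=b\,\frac{(2\tilde\Delta Q(r_1))^{1/2}}{r_1}\int_{-\infty}^{+\infty}\frac{e^{-\frac{(y+\mathfrak{s}_1)^2+(y+\mathfrak{s}_2)^2}{2}}}{\sqrt\pi\,\mathrm{erfc}(y)}\bigg\{\frac{(10y^2-2)e^{-y^2}}{3\sqrt\pi\,\mathrm{erfc}(y)}+5y-\frac{10y^3}{3}+\frac{\mathfrak{s}_1+\mathfrak{s}_2}{b}-y\,\frac{\mathfrak{s}_1^2+\mathfrak{s}_2^2}{2b}-2y^2(\mathfrak{s}_1+\mathfrak{s}_2)+\frac{2b-3}{b}\,\frac{\mathfrak{s}_1^3+\mathfrak{s}_2^3}{6}\bigg\}dy,$$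 and both integrals converge absolutely. -/

import Mathlib

open Real Set Filter Topology MeasureTheory Asymptotics

noncomputable section

namespace HardWall

/-- The model Mittag-Leffler potential with an annular hard wall:
`Q(z) = |z|^{2b} - (2α/n) log |z|` off the gap `r₁ < |z| < r₂`, and `Q = +∞` in the gap.
(At the single point `z = 0` the logarithm takes Lean's value `0`; this is a null set.) -/
def potential (b α r₁ r₂ : ℝ) (n : ℕ) (z : ℂ) : EReal :=
  open Classical in
  if ‖z‖ ∈ Ioo r₁ r₂ then ⊤
  else ((‖z‖ ^ (2 * b) - 2 * α / n * Real.log ‖z‖ : ℝ) : EReal)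

/-- The factor `e^{-n Q(z) / 2}`, which vanishes in the gap. -/
def halfWeight (b α r₁ r₂ : ℝ) (n : ℕ) (z : ℂ) : ℝ :=
  (EReal.exp (-(((n / 2 : ℝ) : EReal) * potential b α r₁ r₂ n z))).toReal

/-- Squared norm of the weighted monomial `z^k e^{-n Q(z) / 2}` in `L²(ℂ, d²z / π)`;
the quantity usually written `h_j` is the one with `k = j - 1`. -/
def monomialNormSq (b α r₁ r₂ : ℝ) (n k : ℕ) : ℝ :=
  (1 / π) * ∫ z : ℂ, ‖z ^ k * (halfWeight b α r₁ r₂ n z : ℂ)‖ ^ 2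

/-- The canonical correlation kernel
`K_n(z,w) = e^{-nQ(z)/2} e^{-nQ(w)/2} ∑_{j=1}^n (z \bar w)^{j-1} / h_j`, with `k = j - 1`. -/
def kernel (b α r₁ r₂ : ℝ) (n : ℕ) (z w : ℂ) : ℂ :=
  (halfWeight b α r₁ r₂ n z : ℂ) * (halfWeight b α r₁ r₂ n w : ℂ) *
    ∑ k ∈ Finset.range n,
      z ^ k * (starRingEnd ℂ w) ^ k / (monomialNormSq b α r₁ r₂ n k : ℂ)

/-- `ΔQ = (Q_xx + Q_yy) / 4`, for the real value of `Q`. -/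
def quarterLaplacian (Q : ℂ → EReal) (z : ℂ) : ℝ :=
  (iteratedDeriv 2 (fun x : ℝ => (Q ⟨x, z.im⟩).toReal) z.re +
    iteratedDeriv 2 (fun y : ℝ => (Q ⟨z.re, y⟩).toReal) z.im) / 4

/-- The limit of `ΔQ(r)` as `r` increases to `r₁`, in closed form. -/
def innerLaplacian (b r₁ : ℝ) : ℝ := b ^ 2 * r₁ ^ (2 * b - 2)

/-- The complementary error function. -/
def erfc (y : ℝ) : ℝ := 2 / √π * ∫ t in Ioi y, Real.exp (-t ^ 2)

/-- The point `r₁ (1 - s / (b r₁^b √(2n))) e^{iβ}`. -/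
def edgePoint (b r₁ β s : ℝ) (n : ℕ) : ℂ :=
  ((r₁ * (1 - s / (b * r₁ ^ b * √(2 * n))) : ℝ) : ℂ) * Complex.exp (Complex.I * β)

/-- `e^{-((y+s₁)² + (y+s₂)²)/2} / (√π erfc y)`. -/
def profile (s₁ s₂ y : ℝ) : ℝ :=
  Real.exp (-((y + s₁) ^ 2 + (y + s₂) ^ 2) / 2) / (√π * erfc y)

/-- The factor in braces in the integrand of the coefficient of `√n`. -/
def correction (b s₁ s₂ y : ℝ) : ℝ :=
  (10 * y ^ 2 - 2) * Real.exp (-y ^ 2) / (3 * √π * erfc y) + 5 * y - 10 * y ^ 3 / 3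
    + (s₁ + s₂) / b - y * (s₁ ^ 2 + s₂ ^ 2) / (2 * b) - 2 * y ^ 2 * (s₁ + s₂)
    + (2 * b - 3) / b * ((s₁ ^ 3 + s₂ ^ 3) / 6)

/-- The coefficient of `n`. -/
def coeffOne (b r₁ s₁ s₂ : ℝ) : ℝ :=
  2 * innerLaplacian b r₁ * ∫ y : ℝ, profile s₁ s₂ y

/-- The coefficient of `√n`. -/
def coeffTwo (b r₁ s₁ s₂ : ℝ) : ℝ :=
  b * √(2 * innerLaplacian b r₁) / r₁ * ∫ y : ℝ, profile s₁ s₂ y * correction b s₁ s₂ y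

theorem iteratedDeriv_two_of_hasDerivAt {f f' : ℝ → ℝ} {x c : ℝ}
    (h1 : ∀ᶠ y in 𝓝 x, HasDerivAt f (f' y) y) (h2 : HasDerivAt f' c x) :
    iteratedDeriv 2 f x = c := by
  have : deriv f =ᶠ[𝓝 x] f' := h1.mono fun y hy => hy.deriv
  rw [iteratedDeriv_succ, iteratedDeriv_one, this.deriv_eq, h2.deriv]

theorem quarterLaplacian_potential {b α r₁ r₂ r : ℝ} (n : ℕ) (hr : 0 < r) (hr₁ : r < r₁) :
    quarterLaplacian (potential b α r₁ r₂ n) r = b ^ 2 * r ^ (2 * b - 2) := by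
  set c : ℝ := 2 * α / n with hc
  have hQ : ∀ z : ℂ, ‖z‖ < r₁ →
      (potential b α r₁ r₂ n z).toReal = ‖z‖ ^ (2 * b) - c * Real.log ‖z‖ := by
    intro z hz
    rw [potential, if_neg (fun h => by linarith [h.1]), EReal.toReal_coe]
  have hx : iteratedDeriv 2 (fun x : ℝ => (potential b α r₁ r₂ n ⟨x, 0⟩).toReal) r
      = 2 * b * ((2 * b - 1) * r ^ (2 * b - 2)) + c / r ^ 2 := by
    refine iteratedDeriv_two_of_hasDerivAt
      (f' := fun x => 2 * b * x ^ (2 * b - 1) - c * x⁻¹) ?_ ?_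
    · filter_upwards [Ioo_mem_nhds hr hr₁] with y hy
      have hy0 : 0 < y := hy.1
      have h1 : HasDerivAt (fun x : ℝ => x ^ (2 * b) - c * Real.log x)
          (2 * b * y ^ (2 * b - 1) - c * y⁻¹) y :=
        (Real.hasDerivAt_rpow_const (Or.inl hy0.ne')).sub
          ((Real.hasDerivAt_log hy0.ne').const_mul c)
      refine h1.congr_of_eventuallyEq ?_
      filter_upwards [Ioo_mem_nhds hy.1 hy.2] with x hx
      have hn : ‖(⟨x, 0⟩ : ℂ)‖ = x := by
        have : (⟨x, 0⟩ : ℂ) = (x : ℂ) := rfl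
        rw [this, Complex.norm_real, Real.norm_of_nonneg hx.1.le]
      rw [hQ _ (by rw [hn]; exact hx.2), hn]
    · have h1 := ((Real.hasDerivAt_rpow_const (p := 2 * b - 1) (Or.inl hr.ne')).const_mul
        (2 * b)).sub ((hasDerivAt_inv hr.ne').const_mul c)
      refine h1.congr_deriv ?_
      rw [show 2 * b - 1 - 1 = 2 * b - 2 by ring]
      ring
  have hy : iteratedDeriv 2 (fun y : ℝ => (potential b α r₁ r₂ n ⟨r, y⟩).toReal) 0
      = 2 * b * r ^ (2 * b - 2) - c / r ^ 2 := by
    have hn : ∀ y : ℝ, ‖(⟨r, y⟩ : ℂ)‖ = √(r ^ 2 + y ^ 2) := by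
      intro y
      rw [Complex.norm_def, Complex.normSq_mk]
      congr 1
      ring
    have hpos : ∀ y : ℝ, 0 < r ^ 2 + y ^ 2 := fun y => by positivity
    have hin : ∀ y : ℝ, HasDerivAt (fun y : ℝ => r ^ 2 + y ^ 2) (2 * y) y := fun y => by
      simpa using (hasDerivAt_pow 2 y).const_add (r ^ 2)
    have hsmall : ∀ᶠ y : ℝ in 𝓝 0, √(r ^ 2 + y ^ 2) < r₁ := by
      have hcont : Continuous fun y : ℝ => √(r ^ 2 + y ^ 2) := by fun_prop
      refine hcont.continuousAt.eventually_lt continuousAt_const ?_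
      simpa [Real.sqrt_sq hr.le] using hr₁
    refine iteratedDeriv_two_of_hasDerivAt (f' := fun y =>
      2 * y * b * (r ^ 2 + y ^ 2) ^ (b - 1) - c / 2 * (2 * y / (r ^ 2 + y ^ 2))) ?_ ?_
    · filter_upwards [hsmall.eventually_nhds] with y hy
      have h1 : HasDerivAt (fun y : ℝ => (r ^ 2 + y ^ 2) ^ b - c / 2 * Real.log (r ^ 2 + y ^ 2))
          (2 * y * b * (r ^ 2 + y ^ 2) ^ (b - 1) - c / 2 * (2 * y / (r ^ 2 + y ^ 2))) y :=
        ((hin y).rpow_const (Or.inl (hpos y).ne')).sub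
          (((hin y).log (hpos y).ne').const_mul (c / 2))
      refine h1.congr_of_eventuallyEq ?_
      filter_upwards [hy] with x hx
      rw [hQ _ (by rw [hn]; exact hx), hn, Real.log_sqrt (hpos x).le, Real.sqrt_eq_rpow,
        ← Real.rpow_mul (hpos x).le, show (1 / 2 : ℝ) * (2 * b) = b by ring]
      ring
    · have h1 := (((hasDerivAt_id (0 : ℝ)).const_mul 2).mul_const b).mul
        ((hin 0).rpow_const (p := b - 1) (Or.inl (hpos 0).ne'))
      have h2 := ((((hasDerivAt_id (0 : ℝ)).const_mul 2).div (hin 0) (hpos 0).ne').const_mul (c / 2))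
      have h3 := h1.sub h2
      refine h3.congr_deriv ?_
      have : (r ^ 2) ^ (b - 1) = r ^ (2 * b - 2) := by
        rw [← Real.rpow_natCast, ← Real.rpow_mul hr.le]
        congr 1
        push_cast
        ring
      simp [this]
      field_simp
  have hre : (r : ℂ).re = r := Complex.ofReal_re r
  have him : (r : ℂ).im = 0 := Complex.ofReal_im r
  rw [quarterLaplacian, hre, him, hx, hy]
  ring

/-- `innerLaplacian` is the one-sided limit of `ΔQ` at the inner edge of the gap. -/
theorem tendsto_quarterLaplacian {b α r₁ r₂ : ℝ} (n : ℕ) (hr₁ : 0 < r₁) :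
    Tendsto (fun r : ℝ => quarterLaplacian (potential b α r₁ r₂ n) r) (𝓝[<] r₁)
      (𝓝 (innerLaplacian b r₁)) := by
  have h1 : ContinuousAt (fun r : ℝ => b ^ 2 * r ^ (2 * b - 2)) r₁ :=
    (Real.continuousAt_rpow_const _ _ (Or.inl hr₁.ne')).const_mul _
  refine (h1.tendsto.mono_left nhdsWithin_le_nhds).congr' ?_
  filter_upwards [Ioo_mem_nhdsLT hr₁] with r hr
  exact (quarterLaplacian_potential n hr.1 hr.2).symm

theorem halfWeight_gap {b α r₁ r₂ : ℝ} {n : ℕ} (hn : 0 < n) {z : ℂ} (h : ‖z‖ ∈ Ioo r₁ r₂) :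
    halfWeight b α r₁ r₂ n z = 0 := by
  have h2 : (0 : ℝ) < n / 2 := by positivity
  rw [halfWeight, potential, if_pos h, EReal.coe_mul_top_of_pos h2]
  simp

theorem halfWeight_off_gap {b α r₁ r₂ : ℝ} {n : ℕ} (hn : 0 < n) {z : ℂ} (hz : z ≠ 0)
    (h : ‖z‖ ∉ Ioo r₁ r₂) :
    halfWeight b α r₁ r₂ n z = ‖z‖ ^ α * Real.exp (-(n / 2 * ‖z‖ ^ (2 * b))) := by
  have hz' : 0 < ‖z‖ := norm_pos_iff.2 hz
  rw [halfWeight, potential, if_neg h, ← EReal.coe_mul, ← EReal.coe_neg, EReal.exp_coe,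
    ENNReal.toReal_ofReal (Real.exp_pos _).le, Real.rpow_def_of_pos hz' α, ← Real.exp_add]
  congr 1
  have : (n : ℝ) ≠ 0 := by positivity
  field_simp
  ring

theorem halfWeight_congr {b α r₁ r₂ : ℝ} {n : ℕ} {z w : ℂ} (h : ‖z‖ = ‖w‖) :
    halfWeight b α r₁ r₂ n z = halfWeight b α r₁ r₂ n w := by
  simp only [halfWeight, potential, h]

theorem halfWeight_measurable (b α r₁ r₂ : ℝ) (n : ℕ) :
    Measurable (halfWeight b α r₁ r₂ n) := by
  classical
  have hp : Measurable (potential b α r₁ r₂ n) := by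
    unfold potential
    refine Measurable.ite (measurableSet_Ioo.preimage measurable_norm) measurable_const ?_
    exact measurable_coe_real_ereal.comp (by fun_prop)
  unfold halfWeight
  refine ENNReal.measurable_toReal.comp (EReal.measurable_exp.comp ?_)
  exact (hp.const_mul _).neg

theorem integrable_weighted {b α r₁ r₂ : ℝ} {n : ℕ} (hb : 0 < b) (hα : -1 < α) (hn : 0 < n)
    (j k : ℕ) :
    Integrable (fun z : ℂ => (z ^ j * (halfWeight b α r₁ r₂ n z : ℂ)) *
      starRingEnd ℂ (z ^ k * (halfWeight b α r₁ r₂ n z : ℂ))) := by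
  have hn' : (0 : ℝ) < n := by exact_mod_cast hn
  have h1 : Integrable (fun z : ℂ =>
      (fun y : ℝ => y ^ ((j + k : ℕ) + 2 * α) * Real.exp (-(n : ℝ) * y ^ (2 * b))) ‖z‖) := by
    rw [integrable_fun_norm_addHaar (volume : Measure ℂ) (f := fun y : ℝ =>
      y ^ ((j + k : ℕ) + 2 * α) * Real.exp (-(n : ℝ) * y ^ (2 * b)))]
    have h2 := integrableOn_rpow_mul_exp_neg_mul_rpow
      (s := 1 + ((j + k : ℕ) + 2 * α)) (p := 2 * b) (b := n)
      (by have : (0 : ℝ) ≤ ((j + k : ℕ) : ℝ) := by positivity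
          linarith) (by positivity) hn'
    refine h2.congr_fun (fun y hy => ?_) measurableSet_Ioi
    simp only [Complex.finrank_real_complex, smul_eq_mul]
    rw [Real.rpow_add hy, Real.rpow_one]
    norm_num
    ring
  have hm := halfWeight_measurable b α r₁ r₂ n
  refine h1.mono' ?_ ?_
  · have : Measurable fun z : ℂ => (halfWeight b α r₁ r₂ n z : ℂ) :=
      Complex.measurable_ofReal.comp hm
    refine Measurable.aestronglyMeasurable ?_
    refine Measurable.mul (by fun_prop) ?_
    exact Complex.continuous_conj.measurable.comp (by fun_prop)
  · have h0 : ∀ᵐ z : ℂ, z ≠ 0 := by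
      simp [ae_iff]
    filter_upwards [h0] with z hz
    have hz' : 0 < ‖z‖ := norm_pos_iff.2 hz
    by_cases h : ‖z‖ ∈ Ioo r₁ r₂
    · rw [halfWeight_gap hn h]
      simp only [Complex.ofReal_zero, mul_zero, map_zero, norm_zero]
      positivity
    · rw [halfWeight_off_gap hn hz h]
      have hW : 0 ≤ ‖z‖ ^ α * Real.exp (-(n / 2 * ‖z‖ ^ (2 * b))) := by positivity
      simp only [norm_mul, RCLike.norm_conj, norm_pow, Complex.norm_real, Real.norm_of_nonneg hW]
      rw [Real.rpow_add hz', Real.rpow_natCast, two_mul α, Real.rpow_add hz',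
        show -(n : ℝ) * ‖z‖ ^ (2 * b) = -(n / 2 * ‖z‖ ^ (2 * b)) + -(n / 2 * ‖z‖ ^ (2 * b)) by ring,
        Real.exp_add, pow_add]
      apply le_of_eq
      ring

theorem integral_weighted_of_ne {b α r₁ r₂ : ℝ} {n : ℕ} {j k : ℕ} (hjk : j ≠ k) :
    ∫ z : ℂ, (z ^ j * (halfWeight b α r₁ r₂ n z : ℂ)) *
      starRingEnd ℂ (z ^ k * (halfWeight b α r₁ r₂ n z : ℂ)) = 0 := by
  set t : ℝ := π / ((j : ℝ) - k) with ht
  have hjk' : (j : ℝ) - k ≠ 0 := sub_ne_zero.2 (by exact_mod_cast hjk)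
  set c : Circle := Circle.exp t with hc
  set f : ℂ → ℂ := fun z => (z ^ j * (halfWeight b α r₁ r₂ n z : ℂ)) *
      starRingEnd ℂ (z ^ k * (halfWeight b α r₁ r₂ n z : ℂ)) with hf
  have hrot : ∀ z, f (rotation c z) = - f z := by
    intro z
    have hnorm : ‖rotation c z‖ = ‖z‖ := (rotation c).norm_map z
    have hcc : (c : ℂ) ^ j * starRingEnd ℂ ((c : ℂ) ^ k) = -1 := by
      rw [hc, Circle.coe_exp, map_pow, ← Complex.exp_conj, ← Complex.exp_nat_mul,
        ← Complex.exp_nat_mul, ← Complex.exp_add]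
      have : (j : ℂ) * (t * Complex.I) + (k : ℂ) * starRingEnd ℂ (t * Complex.I)
          = π * Complex.I := by
        simp only [map_mul, Complex.conj_ofReal, Complex.conj_I]
        have h2 : ((j : ℂ) - k) * t = π := by
          rw [ht]
          have : ((j : ℂ) - k) ≠ 0 := by exact_mod_cast hjk'
          push_cast
          field_simp
        linear_combination Complex.I * h2
      rw [this, Complex.exp_pi_mul_I]
    simp only [hf, halfWeight_congr hnorm]
    simp only [rotation_apply, mul_pow, map_mul]
    linear_combination (z ^ j * (halfWeight b α r₁ r₂ n z : ℂ) * (starRingEnd ℂ (z ^ k) *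
      starRingEnd ℂ (halfWeight b α r₁ r₂ n z : ℂ))) * hcc
  have h1 : ∫ z, f (rotation c z) = ∫ z, f z :=
    (rotation c).measurePreserving.integral_comp
      (rotation c).toHomeomorph.measurableEmbedding f
  simp only [hrot, integral_neg] at h1
  exact self_eq_neg.1 h1.symm

theorem integral_weighted_self (b α r₁ r₂ : ℝ) (n k : ℕ) :
    (1 / π : ℂ) * ∫ z : ℂ, (z ^ k * (halfWeight b α r₁ r₂ n z : ℂ)) *
      starRingEnd ℂ (z ^ k * (halfWeight b α r₁ r₂ n z : ℂ)) = monomialNormSq b α r₁ r₂ n k := by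
  simp only [Complex.mul_conj', monomialNormSq]
  push_cast
  congr 1
  rw [← integral_complex_ofReal]
  push_cast
  rfl

theorem monomialNormSq_pos {b α r₁ r₂ : ℝ} {n : ℕ} (hb : 0 < b) (hα : -1 < α) (hr₁ : 0 < r₁)
    (hn : 0 < n) (k : ℕ) : 0 < monomialNormSq b α r₁ r₂ n k := by
  unfold monomialNormSq
  refine mul_pos (by positivity) ?_
  have hint := (integrable_weighted (r₁ := r₁) (r₂ := r₂) hb hα hn k k).norm
  simp only [norm_mul _ (starRingEnd ℂ _), RCLike.norm_conj, ← sq] at hint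
  rw [integral_pos_iff_support_of_nonneg (fun z => by positivity) hint]
  have hsub : Metric.ball (0 : ℂ) r₁ \ {0} ⊆
      Function.support fun z : ℂ => ‖z ^ k * (halfWeight b α r₁ r₂ n z : ℂ)‖ ^ 2 := by
    rintro z ⟨hz, hz0⟩
    have hz0 : z ≠ 0 := hz0
    have hz' : 0 < ‖z‖ := norm_pos_iff.2 hz0
    have hz1 : ‖z‖ < r₁ := by simpa using hz
    have : halfWeight b α r₁ r₂ n z ≠ 0 := by
      rw [halfWeight_off_gap hn hz0 (fun h => by linarith [h.1])]
      positivity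
    simp [hz0, this]
  refine lt_of_lt_of_le ?_ (measure_mono hsub)
  rw [measure_sdiff_null (by simp)]
  exact Metric.measure_ball_pos _ _ hr₁

/-- `kernel` is a weighted polynomial of degree at most `n - 1` in its first variable. -/
theorem kernel_mem (b α r₁ r₂ : ℝ) (n : ℕ) (w : ℂ) :
    ∃ q : Polynomial ℂ, q.degree < n ∧
      ∀ z, kernel b α r₁ r₂ n z w = q.eval z * (halfWeight b α r₁ r₂ n z : ℂ) := by
  refine ⟨∑ k ∈ Finset.range n, Polynomial.C ((halfWeight b α r₁ r₂ n w : ℂ) *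
    (starRingEnd ℂ w) ^ k / (monomialNormSq b α r₁ r₂ n k : ℂ)) * Polynomial.X ^ k, ?_, ?_⟩
  · rw [← Polynomial.mem_degreeLT]
    refine Submodule.sum_mem _ fun k hk => ?_
    rw [Polynomial.mem_degreeLT]
    exact (Polynomial.degree_C_mul_X_pow_le k _).trans_lt
      (by exact_mod_cast Finset.mem_range.1 hk)
  · intro z
    simp only [kernel, Polynomial.eval_finsetSum, Polynomial.eval_mul, Polynomial.eval_C,
      Polynomial.eval_pow, Polynomial.eval_X, Finset.mul_sum, Finset.sum_mul]
    refine Finset.sum_congr rfl fun k _ => ?_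
    ring

/-- `kernel` is the reproducing kernel of the space of weighted polynomials of degree at most
`n - 1` in `L²(ℂ, d²z / π)`. -/
theorem kernel_reproducing {b α r₁ r₂ : ℝ} {n : ℕ} (hb : 0 < b) (hα : -1 < α) (hr₁ : 0 < r₁)
    (hn : 0 < n) (p : Polynomial ℂ) (hp : p.degree < n) (w : ℂ) :
    (1 / π : ℂ) * ∫ z : ℂ, (p.eval z * (halfWeight b α r₁ r₂ n z : ℂ)) *
        starRingEnd ℂ (kernel b α r₁ r₂ n z w)
      = p.eval w * (halfWeight b α r₁ r₂ n w : ℂ) := by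
  have hp' : p.natDegree < n := by
    by_cases h0 : p = 0
    · simpa [h0] using hn
    · exact (Polynomial.natDegree_lt_iff_degree_lt h0).2 hp
  set W : ℂ → ℂ := fun z => (halfWeight b α r₁ r₂ n z : ℂ) with hW
  set h : ℕ → ℂ := fun k => (monomialNormSq b α r₁ r₂ n k : ℂ) with hh
  have hh0 : ∀ k, h k ≠ 0 := fun k => by
    have := (monomialNormSq_pos (r₂ := r₂) hb hα hr₁ hn k).ne'
    simpa [hh] using this
  have hexp : ∀ z, (p.eval z * W z) * starRingEnd ℂ (kernel b α r₁ r₂ n z w) =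
      ∑ j ∈ Finset.range n, ∑ k ∈ Finset.range n, (p.coeff j * (W w * w ^ k / h k)) *
        ((z ^ j * W z) * starRingEnd ℂ (z ^ k * W z)) := by
    intro z
    rw [Polynomial.eval_eq_sum_range' hp', kernel]
    simp only [map_mul, map_sum, map_div₀, map_pow, Complex.conj_conj, Complex.conj_ofReal, hW, hh,
      Finset.sum_mul, Finset.mul_sum]
    rw [Finset.sum_comm]
    refine Finset.sum_congr rfl fun j _ => Finset.sum_congr rfl fun k _ => ?_
    ring
  have hI := fun j k => integrable_weighted (r₁ := r₁) (r₂ := r₂) hb hα hn j k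
  simp only [hW] at hexp
  simp only [hexp]
  rw [integral_finsetSum _ fun j _ => integrable_finsetSum _ fun k _ => (hI j k).const_mul _,
    Polynomial.eval_eq_sum_range' hp', Finset.mul_sum, Finset.sum_mul]
  refine Finset.sum_congr rfl fun j hj => ?_
  rw [integral_finsetSum _ fun k _ => (hI j k).const_mul _, Finset.sum_eq_single j]
  · rw [integral_const_mul, mul_left_comm, integral_weighted_self]
    have := hh0 j
    simp only [hh] at this ⊢
    field_simp
  · intro k _ hkj
    rw [integral_const_mul, integral_weighted_of_ne hkj.symm, mul_zero]
  · exact fun h => absurd hj h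

end HardWall

end

/-! Put κ = r₁^b √(2n). Since z and w have the same argument, z w̄ is positive and the kernel is a
sum of n positive terms. The substitution r = r₁ e^{u/(bκ)} in the radial norm integral turns the
k-th term, up to the common factor bκ/(2r₁²), into the exponential of two edge phases divided by
`innerMass + outerMass`, all evaluated at y_k = ((k+1+α)/b − κ²/2)/κ. These points form an
arithmetic progression with step 1/(bκ). This reduction, `kernel_edgePoint`, is exact.

For large κ the phase (κ²/2)(e^{−2u/κ} − 1 + 2u/κ) is u² − 2u³/(3κ) + O(κ⁻²) for fixed u. Hence the
inner mass is ∫₀^∞ e^{−2yu−u²} du = (√π/2) e^{y²} erfc y plus 2/(3κ) times the third moment, while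
the mass beyond the gap is negligible. With a similar expansion of the edge phases, each term equals
2·`profile`·(1 + `termCorrection`/κ) up to O(κ⁻² e^{−c|y|}), uniformly over all indices
(`exists_term_expansion`). Decay as y → −∞ comes from the Gaussian in the inverse Mills ratio, decay
as y → +∞ from e^{−(s₁+s₂)y}.

The kernel is thus a Riemann sum whose cells are centred at the nodes. The grid runs from about −κ/2
to a positive multiple of κ, the latter because r₂ < b^{−1/(2b)}, so the sum may be compared with
integrals over the whole line (`exists_riemann_error`): error h² for the leading term, by the
midpoint rule, and h for the correction. This leaves b²κ²∫`profile` + b²κ∫`profile`·`termCorrection`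
+ O(1) (`exists_sum_asymptotics`). The parameter α only translates the grid, which is why it is
absent from both coefficients. Finally, the bracket in C₂ differs from `termCorrection` by a term
which, multiplied by `profile`, is a total derivative (`integral_profile_mul_correction`). -/

noncomputable section

namespace HardWall

/-! ### Taylor bounds for the exponential and the phase of the norm integral. -/

/-- The remainder of the exponential series after its linear term. -/
def expRem (x : ℝ) : ℝ := Real.exp x - 1 - x

/-- Drives the chain of Taylor bounds below: each difference vanishes at 0, and its derivative is
the difference treated just before. -/
theorem nonneg_of_hasDerivAt_nonneg {f f' : ℝ → ℝ} (hf : ∀ x, HasDerivAt f (f' x) x)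
    (h0 : f 0 = 0) (hf' : ∀ x, 0 ≤ x → 0 ≤ f' x) {x : ℝ} (hx : 0 ≤ x) : 0 ≤ f x := by
  have hm : MonotoneOn f (Ici 0) := by
    refine monotoneOn_of_deriv_nonneg (convex_Ici 0)
      (fun x _ => (hf x).continuousAt.continuousWithinAt)
      (fun x _ => (hf x).differentiableAt.differentiableWithinAt) (fun x hx => ?_)
    rw [(hf x).deriv]
    rw [interior_Ici] at hx
    exact hf' x (le_of_lt hx)
  have := hm (mem_Ici.2 le_rfl) (mem_Ici.2 hx) hx
  rwa [h0] at this

theorem hasDerivAt_exp_neg (x : ℝ) :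
    HasDerivAt (fun x : ℝ => Real.exp (-x)) (-Real.exp (-x)) x := by
  simpa using (hasDerivAt_neg x).exp

theorem expRem_neg_nonneg (v : ℝ) : 0 ≤ expRem (-v) := by
  have := Real.add_one_le_exp (-v)
  unfold expRem; linarith

theorem expRem_neg_le_sq {v : ℝ} (hv : 0 ≤ v) : expRem (-v) ≤ v ^ 2 / 2 := by
  have := nonneg_of_hasDerivAt_nonneg (f := fun v => v ^ 2 / 2 - expRem (-v))
    (f' := fun v => v - 1 + Real.exp (-v)) (fun x => ?_) (by simp [expRem])
    (fun x _ => by have := Real.add_one_le_exp (-x); linarith) hv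
  · simpa using this
  · unfold expRem
    have := (((hasDerivAt_pow 2 x).div_const 2).sub
      (((hasDerivAt_exp_neg x).sub_const 1).sub (hasDerivAt_neg x)))
    refine this.congr_deriv ?_
    norm_num; ring

theorem cubic_le_expRem_neg {v : ℝ} (hv : 0 ≤ v) : v ^ 2 / 2 - v ^ 3 / 6 ≤ expRem (-v) := by
  have := nonneg_of_hasDerivAt_nonneg (f := fun v => expRem (-v) - (v ^ 2 / 2 - v ^ 3 / 6))
    (f' := fun v => v ^ 2 / 2 - expRem (-v)) (fun x => ?_) (by simp [expRem])
    (fun x hx => by have := expRem_neg_le_sq hx; linarith) hv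
  · simpa using this
  · unfold expRem
    have := ((((hasDerivAt_exp_neg x).sub_const 1).sub (hasDerivAt_neg x)).sub
      (((hasDerivAt_pow 2 x).div_const 2).sub ((hasDerivAt_pow 3 x).div_const 6)))
    refine this.congr_deriv ?_
    norm_num; ring

theorem expRem_neg_le_quartic {v : ℝ} (hv : 0 ≤ v) :
    expRem (-v) ≤ v ^ 2 / 2 - v ^ 3 / 6 + v ^ 4 / 24 := by
  have := nonneg_of_hasDerivAt_nonneg
    (f := fun v => (v ^ 2 / 2 - v ^ 3 / 6 + v ^ 4 / 24) - expRem (-v))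
    (f' := fun v => expRem (-v) - (v ^ 2 / 2 - v ^ 3 / 6)) (fun x => ?_) (by simp [expRem])
    (fun x hx => by have := cubic_le_expRem_neg hx; linarith) hv
  · simpa using this
  · unfold expRem
    have := (((((hasDerivAt_pow 2 x).div_const 2).sub ((hasDerivAt_pow 3 x).div_const 6)).add
      ((hasDerivAt_pow 4 x).div_const 24)).sub
      (((hasDerivAt_exp_neg x).sub_const 1).sub (hasDerivAt_neg x)))
    refine this.congr_deriv ?_
    norm_num; ring

/-- The cubic Taylor bound turns negative for large v. This one has the right size at both ends,
quadratic near 0 and linear at infinity, and becomes `innerPhase_ge`. -/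
theorem sq_le_two_add_mul_expRem_neg {v : ℝ} (hv : 0 ≤ v) : v ^ 2 ≤ (2 + v) * expRem (-v) := by
  have := nonneg_of_hasDerivAt_nonneg (f := fun v => (2 + v) * Real.exp (-v) - 2 + v)
    (f' := fun v => 1 - (1 + v) * Real.exp (-v)) (fun x => ?_) (by simp)
    (fun x hx => ?_) hv
  · unfold expRem; nlinarith
  · have := (((((hasDerivAt_id x).const_add 2).mul (hasDerivAt_exp_neg x)).sub_const 2).add
      (hasDerivAt_id x))
    refine this.congr_deriv ?_
    simp; ring
  · have h1 := Real.add_one_le_exp x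
    have h2 : Real.exp x * Real.exp (-x) = 1 := by rw [← Real.exp_add]; simp
    nlinarith [Real.exp_pos (-x)]

theorem sq_le_expRem {v : ℝ} (hv : 0 ≤ v) : v ^ 2 / 2 ≤ expRem v := by
  have := Real.quadratic_le_exp_of_nonneg hv
  unfold expRem; linarith

/-- The phase of the norm integral inside the inner disc, in the rescaled logarithmic variable. -/
def innerPhase (κ u : ℝ) : ℝ := κ ^ 2 / 2 * expRem (-(2 * u / κ))

section innerPhase
variable {κ u : ℝ}

theorem innerPhase_le (hκ : 0 < κ) (hu : 0 ≤ u) : innerPhase κ u ≤ u ^ 2 := by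
  have := mul_le_mul_of_nonneg_left (expRem_neg_le_sq (v := 2 * u / κ) (by positivity))
    (show 0 ≤ κ ^ 2 / 2 by positivity)
  refine this.trans (le_of_eq ?_)
  field_simp

theorem le_innerPhase (hκ : 0 < κ) (hu : 0 ≤ u) :
    u ^ 2 - 2 / 3 * u ^ 3 / κ ≤ innerPhase κ u := by
  have := mul_le_mul_of_nonneg_left (cubic_le_expRem_neg (v := 2 * u / κ) (by positivity))
    (show 0 ≤ κ ^ 2 / 2 by positivity)
  refine le_trans (le_of_eq ?_) this
  field_simp; ring

theorem innerPhase_le_quartic (hκ : 0 < κ) (hu : 0 ≤ u) :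
    innerPhase κ u ≤ u ^ 2 - 2 / 3 * u ^ 3 / κ + u ^ 4 / (3 * κ ^ 2) := by
  have := mul_le_mul_of_nonneg_left (expRem_neg_le_quartic (v := 2 * u / κ) (by positivity))
    (show 0 ≤ κ ^ 2 / 2 by positivity)
  refine this.trans (le_of_eq ?_)
  field_simp; ring

theorem innerPhase_ge (hκ : 0 < κ) (hu : 0 ≤ u) :
    κ * u ^ 2 / (κ + u) ≤ innerPhase κ u := by
  have h := sq_le_two_add_mul_expRem_neg (v := 2 * u / κ) (by positivity)
  have h1 : 2 + 2 * u / κ = 2 * (κ + u) / κ := by field_simp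
  have h2 : (2 * u / κ) ^ 2 * (κ ^ 2 / 2) = 2 * u ^ 2 := by field_simp
  have h3 := mul_le_mul_of_nonneg_right h (show 0 ≤ κ ^ 2 / 2 by positivity)
  rw [div_le_iff₀ (by positivity)]
  unfold innerPhase
  rw [h2, h1] at h3
  have h4 : 2 * (κ + u) / κ * expRem (-(2 * u / κ)) * (κ ^ 2 / 2)
    = κ * (κ + u) * expRem (-(2 * u / κ)) := by field_simp
  rw [h4] at h3
  nlinarith

theorem continuous_innerPhase (κ : ℝ) : Continuous (innerPhase κ) := by
  unfold innerPhase expRem; fun_prop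

/-- An integrable majorant uniform in κ. For u ≤ κ/9 the phase is at least 9u²/10 and absorbs −2yu
at the cost e^{5m²/4}, m = min(y, 0). For u > κ/9 it is at least κu/10, of which y ≥ −κ/40 uses up
at most half. -/
theorem exp_innerPhase_le (hκ : 1 ≤ κ) {y : ℝ} (hy : -(κ / 40) ≤ y) (hu : 0 ≤ u) :
    Real.exp (-(2 * y * u) - innerPhase κ u) ≤
      3 * Real.exp (5 / 4 * (min y 0) ^ 2) * Real.exp (-(u / 20)) := by
  have hκ0 : 0 < κ := by linarith
  have hP := innerPhase_ge hκ0 hu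
  set m := min y 0 with hm
  have hmy : m ≤ y := min_le_left _ _
  have h3 : Real.exp (1 / 160) ≤ 3 :=
    (Real.exp_le_exp.2 (by norm_num)).trans Real.exp_one_lt_three.le
  -- The constant 1/160 completes a square: u²/10 − u/20 + 1/160 = (u − 1/4)²/10.
  have key : -(2 * y * u) - innerPhase κ u ≤ 1 / 160 + 5 / 4 * m ^ 2 + -(u / 20) := by
    rcases le_or_gt u (κ / 9) with h | h
    · have h1 : 9 / 10 * u ^ 2 ≤ κ * u ^ 2 / (κ + u) := by
        rw [le_div_iff₀ (by positivity)]
        nlinarith [sq_nonneg u]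
      have h2 : -(2 * m * u) ≤ 5 / 4 * m ^ 2 + 4 / 5 * u ^ 2 := by
        nlinarith [sq_nonneg (5 * m + 4 * u)]
      nlinarith [sq_nonneg (u - 1 / 4), mul_le_mul_of_nonneg_right hmy hu]
    · have h1 : κ * u / 10 ≤ κ * u ^ 2 / (κ + u) := by
        rw [le_div_iff₀ (by positivity)]
        have : 0 ≤ κ * u := by positivity
        nlinarith
      nlinarith [mul_le_mul_of_nonneg_right hy hu, mul_le_mul_of_nonneg_right hκ hu, sq_nonneg m]
  calc _ ≤ Real.exp (1 / 160 + 5 / 4 * m ^ 2 + -(u / 20)) := Real.exp_le_exp.2 key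
    _ = Real.exp (1 / 160) * Real.exp (5 / 4 * m ^ 2) * Real.exp (-(u / 20)) := by
      rw [Real.exp_add, Real.exp_add]
    _ ≤ _ := by gcongr

end innerPhase

/-! ### Half-line Gaussian moments, erfc and the inverse Mills ratio. -/

theorem integrableOn_pow_mul_exp_neg (k : ℕ) {c : ℝ} (hc : 0 < c) :
    IntegrableOn (fun u : ℝ => u ^ k * Real.exp (-(c * u))) (Ioi 0) := by
  have := integrableOn_rpow_mul_exp_neg_mul_rpow (s := k) (p := 1) (b := c)
    (by have : (0 : ℝ) ≤ k := by positivity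
        linarith) one_pos hc
  refine this.congr_fun (fun u _ => ?_) measurableSet_Ioi
  simp

/-- The half-line Gaussian moments. -/
def gaussMoment (k : ℕ) (y : ℝ) : ℝ := ∫ u in Ioi (0 : ℝ), u ^ k * Real.exp (-(2 * y * u) - u ^ 2)

theorem integrableOn_gaussMoment (k : ℕ) (y : ℝ) :
    IntegrableOn (fun u : ℝ => u ^ k * Real.exp (-(2 * y * u) - u ^ 2)) (Ioi 0) := by
  refine ((integrableOn_pow_mul_exp_neg k one_pos).const_mul (Real.exp ((1 - 2 * y) ^ 2 / 4))).mono'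
    (by fun_prop) ?_
  filter_upwards [ae_restrict_mem measurableSet_Ioi] with u hu
  have hu : 0 < u := hu
  rw [Real.norm_of_nonneg (by positivity), mul_left_comm, ← Real.exp_add]
  gcongr
  nlinarith [sq_nonneg (u - (1 - 2 * y) / 2)]

theorem tendsto_pow_mul_exp_gauss (k : ℕ) (y : ℝ) :
    Tendsto (fun u : ℝ => u ^ k * Real.exp (-(2 * y * u) - u ^ 2)) atTop (𝓝 0) := by
  have h := (Real.tendsto_pow_mul_exp_neg_atTop_nhds_zero k).const_mul
    (Real.exp ((1 - 2 * y) ^ 2 / 4))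
  rw [mul_zero] at h
  refine squeeze_zero' ?_ ?_ h
  · filter_upwards [eventually_ge_atTop 0] with u hu
    positivity
  · filter_upwards [eventually_ge_atTop 0] with u hu
    rw [mul_left_comm, ← Real.exp_add]
    gcongr
    nlinarith [sq_nonneg (u - (1 - 2 * y) / 2)]

theorem hasDerivAt_exp_gauss (y u : ℝ) : HasDerivAt (fun u : ℝ => Real.exp (-(2 * y * u) - u ^ 2))
    (Real.exp (-(2 * y * u) - u ^ 2) * (-(2 * y) - 2 * u)) u := by
  have := ((((hasDerivAt_id u).const_mul (2 * y)).neg).sub (hasDerivAt_pow 2 u)).exp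
  refine this.congr_deriv ?_
  simp

theorem gaussMoment_one (y : ℝ) : gaussMoment 1 y = 1 / 2 - y * gaussMoment 0 y := by
  have h := integral_Ioi_of_hasDerivAt_of_tendsto' (a := 0) (m := 0)
    (f := fun u : ℝ => u ^ 0 * Real.exp (-(2 * y * u) - u ^ 2))
    (f' := fun u => (-(2 * y)) * (u ^ 0 * Real.exp (-(2 * y * u) - u ^ 2))
      - 2 * (u ^ 1 * Real.exp (-(2 * y * u) - u ^ 2)))
    (fun u _ => ?_) ?_ (tendsto_pow_mul_exp_gauss 0 y)
  · rw [integral_sub ((integrableOn_gaussMoment 0 y).const_mul _)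
      ((integrableOn_gaussMoment 1 y).const_mul _), integral_const_mul, integral_const_mul] at h
    change -(2 * y) * gaussMoment 0 y - 2 * gaussMoment 1 y = _ at h
    norm_num at h
    linarith
  · simp only [pow_zero, one_mul, pow_one]
    refine (hasDerivAt_exp_gauss y u).congr_deriv ?_
    ring
  · exact ((integrableOn_gaussMoment 0 y).const_mul _).sub
      ((integrableOn_gaussMoment 1 y).const_mul _)

/-- Integration of the derivative of u^{k+1} e^{−2yu−u²}, whose boundary values vanish. The
recursion reduces the third moment, the only one in the first correction, to the zeroth. -/
theorem gaussMoment_add_two (k : ℕ) (y : ℝ) :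
    gaussMoment (k + 2) y = (k + 1) / 2 * gaussMoment k y - y * gaussMoment (k + 1) y := by
  have h := integral_Ioi_of_hasDerivAt_of_tendsto' (a := 0) (m := 0)
    (f := fun u : ℝ => u ^ (k + 1) * Real.exp (-(2 * y * u) - u ^ 2))
    (f' := fun u => ((k + 1 : ℝ) * (u ^ k * Real.exp (-(2 * y * u) - u ^ 2))
      - 2 * y * (u ^ (k + 1) * Real.exp (-(2 * y * u) - u ^ 2)))
      - 2 * (u ^ (k + 2) * Real.exp (-(2 * y * u) - u ^ 2)))
    (fun u _ => ?_) ?_ (tendsto_pow_mul_exp_gauss (k + 1) y)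
  · have i0 := (integrableOn_gaussMoment k y).const_mul (k + 1 : ℝ)
    have i1 := (integrableOn_gaussMoment (k + 1) y).const_mul (2 * y)
    have i2 := (integrableOn_gaussMoment (k + 2) y).const_mul 2
    have i01 := i0.sub i1
    simp only [Pi.sub_def] at i01
    rw [integral_sub i01 i2, integral_sub i0 i1, integral_const_mul, integral_const_mul,
      integral_const_mul] at h
    change (k + 1 : ℝ) * gaussMoment k y - 2 * y * gaussMoment (k + 1) y
      - 2 * gaussMoment (k + 2) y = _ at h
    norm_num at h
    linarith
  · refine ((hasDerivAt_pow (k + 1) u).mul (hasDerivAt_exp_gauss y u)).congr_deriv ?_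
    push_cast
    ring
  · exact (((integrableOn_gaussMoment k y).const_mul _).sub
      ((integrableOn_gaussMoment (k + 1) y).const_mul _)).sub
      ((integrableOn_gaussMoment (k + 2) y).const_mul _)

theorem gaussMoment_three (y : ℝ) :
    gaussMoment 3 y = (1 + y ^ 2) * (1 / 2 - y * gaussMoment 0 y) - y / 2 * gaussMoment 0 y := by
  have h2 := gaussMoment_add_two 0 y
  have h3 := gaussMoment_add_two 1 y
  have h1 := gaussMoment_one y
  norm_num at h2 h3
  rw [h3, h2, h1]; ring

theorem exp_sq_mul_gaussMoment_zero (y : ℝ) :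
    gaussMoment 0 y = Real.exp (y ^ 2) * (√π / 2 * erfc y) := by
  have h1 : ∫ t in Ioi y, Real.exp (-t ^ 2) = ∫ u in Ioi (0 : ℝ), Real.exp (-(u + y) ^ 2) := by
    have h := (measurePreserving_add_right volume y).setIntegral_preimage_emb
      (measurableEmbedding_addRight y) (fun t => Real.exp (-t ^ 2)) (Ioi y)
    rw [← h]
    congr 2
    ext x
    simp
  have h2 : √π ≠ 0 := by positivity
  rw [erfc, ← mul_assoc (√π / 2), show √π / 2 * (2 / √π) = 1 by field_simp, one_mul, h1,
    ← integral_const_mul, gaussMoment]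
  refine setIntegral_congr_fun measurableSet_Ioi fun u _ => ?_
  rw [← Real.exp_add, pow_zero, one_mul]
  congr 1; ring

/-- The integral is bounded below by its part over a window of length 1/(1+|y|) that starts at the
maximiser −min(y, 0) of the exponent. There the exponent stays within 3 of its maximum min(y, 0)².
-/
theorem gaussMoment_zero_ge (y : ℝ) :
    Real.exp (-3) * Real.exp ((min y 0) ^ 2) / (1 + |y|) ≤ gaussMoment 0 y := by
  set m := min y 0 with hm
  have hpos : 0 < 1 + |y| := by positivity
  have hm0 : 0 ≤ -m := by simp [hm]
  set S := Ioc (-m) (-m + 1 / (1 + |y|)) with hS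
  have hsub : S ⊆ Ioi 0 := fun u hu => lt_of_le_of_lt hm0 hu.1
  have hle : ∫ u in S, Real.exp (-3) * Real.exp (m ^ 2) ≤
      ∫ u in S, u ^ 0 * Real.exp (-(2 * y * u) - u ^ 2) := by
    refine setIntegral_mono_on (integrableOn_const (by simp [hS])) ((integrableOn_gaussMoment 0 y).mono_set hsub)
      measurableSet_Ioc fun u hu => ?_
    rw [pow_zero, one_mul, ← Real.exp_add]
    refine Real.exp_le_exp.2 ?_
    have h1 : 0 < u + m := by linarith [hu.1]
    have h2 : (u + m) * (1 + |y|) ≤ 1 := by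
      rw [← le_div_iff₀ hpos]; linarith [hu.2]
    have h3 : u + m ≤ 1 := by nlinarith [abs_nonneg y]
    rcases le_total y 0 with h | h
    · rw [min_eq_left h] at hm
      rw [hm] at h1 h3 ⊢
      nlinarith
    · rw [min_eq_right h] at hm
      rw [hm] at h1 h2 h3 ⊢
      rw [abs_of_nonneg h] at h2
      nlinarith
  have hconst : ∫ u in S, Real.exp (-3) * Real.exp (m ^ 2)
      = Real.exp (-3) * Real.exp (m ^ 2) / (1 + |y|) := by
    rw [setIntegral_const, hS, Real.volume_real_Ioc_of_le (by simp; positivity)]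
    simp; field_simp
  rw [← hconst]
  refine hle.trans (setIntegral_mono_set (integrableOn_gaussMoment 0 y) ?_ hsub.eventuallyLE)
  filter_upwards [ae_restrict_mem measurableSet_Ioi] with u hu
  have hu : 0 < u := hu
  simp only [Pi.zero_apply]; positivity

theorem gaussMoment_zero_pos (y : ℝ) : 0 < gaussMoment 0 y :=
  lt_of_lt_of_le (by positivity) (gaussMoment_zero_ge y)

/-- The inverse Mills ratio `e^{-y²} / (√π erfc y)`. -/
def mills (y : ℝ) : ℝ := Real.exp (-y ^ 2) / (√π * erfc y)

theorem mills_eq (y : ℝ) : mills y = 1 / (2 * gaussMoment 0 y) := by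
  rw [mills, exp_sq_mul_gaussMoment_zero, Real.exp_neg]
  have := Real.exp_pos (y ^ 2)
  rw [show 2 * (Real.exp (y ^ 2) * (√π / 2 * erfc y)) = Real.exp (y ^ 2) * (√π * erfc y) by ring,
    one_div, mul_inv, div_eq_mul_inv]

theorem mills_pos (y : ℝ) : 0 < mills y := by
  rw [mills_eq]; have := gaussMoment_zero_pos y; positivity

theorem mills_le (y : ℝ) : mills y ≤ Real.exp 3 * (1 + |y|) * Real.exp (-(min y 0) ^ 2) := by
  have h := gaussMoment_zero_ge y
  have h0 := gaussMoment_zero_pos y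
  have hpos : 0 < 1 + |y| := by positivity
  rw [mills_eq, div_le_iff₀ (by positivity)]
  rw [div_le_iff₀ hpos] at h
  have h1 : 1 = Real.exp 3 * Real.exp (-(min y 0) ^ 2) * (Real.exp (-3) * Real.exp ((min y 0) ^ 2)) := by
    rw [← Real.exp_add, ← Real.exp_add, ← Real.exp_add, ← Real.exp_zero]
    congr 1; ring
  calc (1 : ℝ) = _ := h1
    _ ≤ Real.exp 3 * Real.exp (-(min y 0) ^ 2) * (gaussMoment 0 y * (1 + |y|)) := by gcongr
    _ ≤ _ := by
      have : 0 ≤ Real.exp 3 * Real.exp (-(min y 0) ^ 2) * (gaussMoment 0 y * (1 + |y|)) := by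
        positivity
      linarith

theorem erfc_pos (y : ℝ) : 0 < erfc y := by
  have h := gaussMoment_zero_pos y
  rw [exp_sq_mul_gaussMoment_zero] at h
  by_contra hn
  have h1 : √π / 2 * erfc y ≤ 0 := mul_nonpos_of_nonneg_of_nonpos (by positivity) (not_lt.1 hn)
  nlinarith [Real.exp_pos (y ^ 2)]

theorem hasDerivAt_erfc (y : ℝ) : HasDerivAt erfc (-(2 / √π) * Real.exp (-y ^ 2)) y := by
  have hint : Integrable fun t : ℝ => Real.exp (-t ^ 2) := by
    simpa using integrable_exp_neg_mul_sq one_pos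
  have hc : Continuous fun t : ℝ => Real.exp (-t ^ 2) := by fun_prop
  have heq : erfc = fun y => 2 / √π * ((∫ t, Real.exp (-t ^ 2)) - ((∫ t in Iic 0, Real.exp (-t ^ 2))
      + ∫ t in (0 : ℝ)..y, Real.exp (-t ^ 2))) := by
    funext y
    rw [erfc, ← intervalIntegral.integral_Iic_sub_Iic hint.integrableOn hint.integrableOn,
      ← integral_add_compl (measurableSet_Iic (a := y)) hint]
    simp
  rw [heq]
  have h1 := (((intervalIntegral.integral_hasDerivAt_right (hint.intervalIntegrable (a := 0) (b := y))
    (hc.stronglyMeasurableAtFilter _ _) hc.continuousAt).const_add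
    (∫ t in Iic 0, Real.exp (-t ^ 2))).const_sub (∫ t, Real.exp (-t ^ 2))).const_mul (2 / √π)
  refine h1.congr_deriv ?_
  ring

/-- A Riccati equation: derivatives of any order remain polynomials in y and `mills y`, so
polynomial growth is inherited by every derivative needed for the Riemann sums. -/
theorem hasDerivAt_mills (y : ℝ) :
    HasDerivAt mills (2 * mills y ^ 2 - 2 * y * mills y) y := by
  have hE := erfc_pos y
  have hπ : √π ≠ 0 := by positivity
  have h1 : HasDerivAt (fun y : ℝ => Real.exp (-y ^ 2)) (Real.exp (-y ^ 2) * (-(2 * y))) y := by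
    have := (hasDerivAt_pow 2 y).neg.exp
    simpa using this
  have h := h1.div ((hasDerivAt_erfc y).const_mul √π) (by positivity)
  refine h.congr_deriv ?_
  unfold mills
  field_simp
  ring

/-! ### The two rescaled masses and the expansion of the reciprocal of their sum. -/

/-- The rescaled mass of the weighted monomial inside the inner disc. -/
def innerMass (κ y : ℝ) : ℝ := ∫ u in Ioi (0 : ℝ), Real.exp (-(2 * y * u) - innerPhase κ u)

/-- The rescaled mass of the weighted monomial beyond the gap. -/
def outerMass (κ L y : ℝ) : ℝ :=
  ∫ u in Ioi L, Real.exp (2 * y * u - κ ^ 2 / 2 * expRem (2 * u / κ))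

/-- The phase is at least κu − κ²/2, so the integrand decays like e^{−(2y+κ)u}. At the grid points
the condition on y amounts to k+1+α > 0. -/
theorem integrableOn_innerMass {κ y : ℝ} (hκ : 0 < κ) (hy : -(κ / 2) < y) :
    IntegrableOn (fun u : ℝ => Real.exp (-(2 * y * u) - innerPhase κ u)) (Ioi 0) := by
  have hc : 0 < 2 * y + κ := by linarith
  have hcont := continuous_innerPhase κ
  refine ((integrableOn_pow_mul_exp_neg 0 hc).const_mul (Real.exp (κ ^ 2 / 2))).mono'
    (by fun_prop) ?_
  filter_upwards with u
  rw [Real.norm_of_nonneg (by positivity), pow_zero, one_mul, ← Real.exp_add]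
  refine Real.exp_le_exp.2 ?_
  have h1 : innerPhase κ u = κ ^ 2 / 2 * (Real.exp (-(2 * u / κ)) - 1) + κ * u := by
    unfold innerPhase expRem
    field_simp; ring
  rw [h1]
  nlinarith [Real.exp_pos (-(2 * u / κ)), sq_nonneg κ,
    mul_nonneg (sq_nonneg κ) (Real.exp_pos (-(2 * u / κ))).le]

/-- This holds on the full range of y, not only where the expansion is valid, and so controls every
term of the kernel from above. -/
theorem gaussMoment_zero_le_innerMass {κ y : ℝ} (hκ : 0 < κ) (hy : -(κ / 2) < y) :
    gaussMoment 0 y ≤ innerMass κ y := by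
  refine setIntegral_mono_on (integrableOn_gaussMoment 0 y) (integrableOn_innerMass hκ hy)
    measurableSet_Ioi fun u hu => ?_
  rw [pow_zero, one_mul]
  gcongr
  exact innerPhase_le hκ (le_of_lt hu)

theorem exp_sub_one_le {A : ℝ} : Real.exp A - 1 ≤ A * Real.exp A := by
  have h := Real.add_one_le_exp (-A)
  have h2 : Real.exp A * Real.exp (-A) = 1 := by rw [← Real.exp_add]; simp
  nlinarith [Real.exp_pos A]

theorem exp_sub_one_sub_le {A : ℝ} (hA : 0 ≤ A) :
    Real.exp A - 1 - A ≤ A ^ 2 * Real.exp A := by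
  have h := exp_sub_one_le (A := A)
  nlinarith [Real.exp_pos A]

/-- The right side keeps the true exponential instead of the Gaussian: u² − `innerPhase κ u` can be
large, and `exp_innerPhase_le` dominates precisely this exponential. -/
theorem innerPhase_first_order {κ u : ℝ} (y : ℝ) (hκ : 0 < κ) (hu : 0 ≤ u) :
    Real.exp (-(2 * y * u) - innerPhase κ u) - Real.exp (-(2 * y * u) - u ^ 2) ≤
      u ^ 3 / κ * Real.exp (-(2 * y * u) - innerPhase κ u) := by
  set A := u ^ 2 - innerPhase κ u with hA
  have hA1 : A ≤ u ^ 3 / κ := by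
    have := le_innerPhase hκ hu
    have h2 : 2 / 3 * u ^ 3 / κ ≤ u ^ 3 / κ := by
      gcongr
      nlinarith [pow_nonneg hu 3]
    linarith
  have he : Real.exp (-(2 * y * u) - innerPhase κ u)
      = Real.exp (-(2 * y * u) - u ^ 2) * Real.exp A := by
    rw [← Real.exp_add, hA]; congr 1; ring
  rw [he]
  have h := exp_sub_one_le (A := A)
  have hp := Real.exp_pos (-(2 * y * u) - u ^ 2)
  have h3 : A * Real.exp A ≤ u ^ 3 / κ * Real.exp A := by gcongr
  nlinarith

theorem innerPhase_second_order {κ u : ℝ} (y : ℝ) (hκ : 0 < κ) (hu : 0 ≤ u) :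
    |Real.exp (-(2 * y * u) - innerPhase κ u) - Real.exp (-(2 * y * u) - u ^ 2)
        - 2 / (3 * κ) * (u ^ 3 * Real.exp (-(2 * y * u) - u ^ 2))| ≤
      (u ^ 4 + u ^ 6) / κ ^ 2 * Real.exp (-(2 * y * u) - innerPhase κ u) := by
  set A := u ^ 2 - innerPhase κ u with hA
  have h23 : 2 / 3 * u ^ 3 / κ = 2 / (3 * κ) * u ^ 3 := by field_simp
  have hA0 : 0 ≤ A := by have := innerPhase_le hκ hu; linarith
  have hA1 : A ≤ 2 / (3 * κ) * u ^ 3 := by have := le_innerPhase hκ hu; linarith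
  have hA2 : 2 / (3 * κ) * u ^ 3 - u ^ 4 / (3 * κ ^ 2) ≤ A := by
    have := innerPhase_le_quartic hκ hu; linarith
  have he : Real.exp (-(2 * y * u) - innerPhase κ u)
      = Real.exp (-(2 * y * u) - u ^ 2) * Real.exp A := by
    rw [← Real.exp_add, hA]; congr 1; ring
  rw [he]
  set G := Real.exp (-(2 * y * u) - u ^ 2) with hG
  have hG0 : 0 < G := Real.exp_pos _
  have hE1 : 1 ≤ Real.exp A := Real.one_le_exp hA0
  have hE := Real.add_one_le_exp A
  have hsq : A ^ 2 ≤ u ^ 6 / κ ^ 2 := by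
    have : A ^ 2 ≤ (2 / (3 * κ) * u ^ 3) ^ 2 := by gcongr
    have h4 : (2 / (3 * κ) * u ^ 3) ^ 2 = 4 / 9 * (u ^ 6 / κ ^ 2) := by field_simp; ring
    have h5 : 0 ≤ u ^ 6 / κ ^ 2 := by positivity
    linarith
  have h4 : 0 ≤ u ^ 4 / κ ^ 2 := by positivity
  have h4' : u ^ 4 / (3 * κ ^ 2) = 1 / 3 * (u ^ 4 / κ ^ 2) := by field_simp
  have h6 : 0 ≤ u ^ 6 / κ ^ 2 := by positivity
  have main : |Real.exp A - 1 - 2 / (3 * κ) * u ^ 3| ≤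
      (u ^ 4 / κ ^ 2 + u ^ 6 / κ ^ 2) * Real.exp A := by
    rw [abs_le]
    constructor
    · nlinarith
    · have := exp_sub_one_sub_le hA0
      have h7 : A ^ 2 * Real.exp A ≤ u ^ 6 / κ ^ 2 * Real.exp A := by gcongr
      nlinarith
  have hfac : G * Real.exp A - G - 2 / (3 * κ) * (u ^ 3 * G)
      = G * (Real.exp A - 1 - 2 / (3 * κ) * u ^ 3) := by ring
  rw [hfac, abs_mul, abs_of_pos hG0, add_div]
  nlinarith [mul_le_mul_of_nonneg_left main hG0.le]

/-- Both orders are needed: the second is the linear term in the expansion of the reciprocal, and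
the square of the first is its quadratic remainder. -/
theorem exists_innerMass_sub_le : ∃ C : ℝ, 0 < C ∧ ∀ κ y : ℝ, 1 ≤ κ → -(κ / 40) ≤ y →
    innerMass κ y - gaussMoment 0 y ≤ C / κ * Real.exp (5 / 4 * (min y 0) ^ 2) ∧
    |innerMass κ y - gaussMoment 0 y - 2 / (3 * κ) * gaussMoment 3 y| ≤
      C / κ ^ 2 * Real.exp (5 / 4 * (min y 0) ^ 2) := by
  have hc : (0 : ℝ) < 1 / 20 := by norm_num
  have i3 := integrableOn_pow_mul_exp_neg 3 hc
  have i4 := integrableOn_pow_mul_exp_neg 4 hc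
  have i6 := integrableOn_pow_mul_exp_neg 6 hc
  set C3 := ∫ u in Ioi (0 : ℝ), u ^ 3 * Real.exp (-(1 / 20 * u)) with hC3
  set C46 := ∫ u in Ioi (0 : ℝ), (u ^ 4 * Real.exp (-(1 / 20 * u)) + u ^ 6 * Real.exp (-(1 / 20 * u)))
    with hC46
  have hC3' : 0 ≤ C3 := setIntegral_nonneg measurableSet_Ioi fun u (hu : 0 < u) => by positivity
  have hC46' : 0 ≤ C46 := setIntegral_nonneg measurableSet_Ioi fun u (hu : 0 < u) => by positivity
  refine ⟨3 * C3 + 3 * C46 + 1, by positivity, fun κ y hκ hy => ?_⟩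
  have hκ0 : 0 < κ := by linarith
  have iD := integrableOn_innerMass hκ0 (y := y) (by linarith)
  have g0 := integrableOn_gaussMoment 0 y
  have g3 := integrableOn_gaussMoment 3 y
  simp only [pow_zero, one_mul] at g0
  have hg0 : gaussMoment 0 y = ∫ u in Ioi (0 : ℝ), Real.exp (-(2 * y * u) - u ^ 2) := by
    simp [gaussMoment]
  set M := Real.exp (5 / 4 * (min y 0) ^ 2) with hM
  have hM0 : 0 < M := Real.exp_pos _
  have hdom : ∀ u, 0 < u → Real.exp (-(2 * y * u) - innerPhase κ u) ≤
      3 * M * Real.exp (-(1 / 20 * u)) := fun u hu => by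
    have := exp_innerPhase_le hκ hy hu.le
    rwa [show u / 20 = 1 / 20 * u by ring] at this
  constructor
  · have h1 : innerMass κ y - gaussMoment 0 y ≤ ∫ u in Ioi (0 : ℝ),
        3 * M / κ * (u ^ 3 * Real.exp (-(1 / 20 * u))) := by
      rw [innerMass, hg0, ← integral_sub iD g0]
      refine setIntegral_mono_on (iD.sub g0) (i3.const_mul _) measurableSet_Ioi fun u hu => ?_
      have hu : 0 < u := hu
      refine (innerPhase_first_order y hκ0 hu.le).trans ?_
      calc _ ≤ u ^ 3 / κ * (3 * M * Real.exp (-(1 / 20 * u))) := by gcongr; exact hdom u hu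
        _ = _ := by ring
    rw [integral_const_mul, ← hC3] at h1
    refine h1.trans ?_
    rw [show 3 * M / κ * C3 = 3 * C3 / κ * M by ring]
    gcongr
    linarith
  · have iDg := iD.sub g0
    simp only [Pi.sub_def] at iDg
    have h1 : |innerMass κ y - gaussMoment 0 y - 2 / (3 * κ) * gaussMoment 3 y| ≤
        ∫ u in Ioi (0 : ℝ), 3 * M / κ ^ 2 *
          (u ^ 4 * Real.exp (-(1 / 20 * u)) + u ^ 6 * Real.exp (-(1 / 20 * u))) := by
      rw [innerMass, hg0, ← integral_sub iD g0, gaussMoment, ← integral_const_mul,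
        ← integral_sub iDg (g3.const_mul _)]
      rw [← Real.norm_eq_abs]
      refine norm_integral_le_of_norm_le ((i4.add i6).const_mul _) ?_
      filter_upwards [ae_restrict_mem measurableSet_Ioi] with u hu
      have hu : 0 < u := hu
      refine (innerPhase_second_order y hκ0 hu.le).trans ?_
      calc _ ≤ (u ^ 4 + u ^ 6) / κ ^ 2 * (3 * M * Real.exp (-(1 / 20 * u))) := by
            gcongr; exact hdom u hu
        _ = _ := by ring
    rw [integral_const_mul, ← hC46] at h1
    refine h1.trans ?_
    rw [show 3 * M / κ ^ 2 * C46 = 3 * C46 / κ ^ 2 * M by ring]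
    gcongr
    linarith

theorem outerMass_nonneg (κ L y : ℝ) : 0 ≤ outerMass κ L y :=
  integral_nonneg fun _ => (Real.exp_pos _).le

/-- Beyond the gap the phase is at least u² ≥ κlu, while 2yu ≤ κlu/2, so e^{−κlu/2} remains. The
result is exponentially small in κ², but order κ⁻² suffices. -/
theorem outerMass_le {κ l y : ℝ} (hκ : 1 ≤ κ) (hl : 0 < l) (hy : y ≤ κ * l / 4) :
    outerMass κ (κ * l) y ≤ 4 / l ^ 3 / κ ^ 2 := by
  have hκ0 : 0 < κ := by linarith
  have ha : -(κ * l / 2) < 0 := by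
    have : 0 < κ * l := by positivity
    linarith
  have h1 : outerMass κ (κ * l) y ≤ ∫ u in Ioi (κ * l), Real.exp (-(κ * l / 2) * u) := by
    refine integral_mono_of_nonneg (Eventually.of_forall fun u => (Real.exp_pos _).le)
      (integrableOn_exp_mul_Ioi ha _) ?_
    filter_upwards [ae_restrict_mem measurableSet_Ioi] with u hu
    have hu : κ * l < u := hu
    have hu0 : 0 < u := lt_trans (by positivity) hu
    have h2 : u ^ 2 ≤ κ ^ 2 / 2 * expRem (2 * u / κ) := by
      have := mul_le_mul_of_nonneg_left (sq_le_expRem (v := 2 * u / κ) (by positivity))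
        (show 0 ≤ κ ^ 2 / 2 by positivity)
      refine le_trans (le_of_eq ?_) this
      field_simp
    refine Real.exp_le_exp.2 ?_
    nlinarith
  refine h1.trans ?_
  rw [integral_exp_mul_Ioi ha]
  set x := κ * l / 2 * (κ * l) with hx
  have hx0 : 0 < x := by positivity
  have h3 : Real.exp (-x) ≤ 1 / x := by
    rw [Real.exp_neg, inv_eq_one_div]
    gcongr
    linarith [Real.add_one_le_exp x]
  have h4 : -Real.exp (-(κ * l / 2) * (κ * l)) / -(κ * l / 2) = Real.exp (-x) / (κ * l / 2) := by
    rw [neg_div_neg_eq, hx]; congr 2; ring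
  rw [h4]
  calc Real.exp (-x) / (κ * l / 2) ≤ 1 / x / (κ * l / 2) := by gcongr
    _ = 4 / l ^ 3 / κ ^ 2 * (1 / κ) := by rw [hx]; field_simp; norm_num
    _ ≤ 4 / l ^ 3 / κ ^ 2 * 1 := by
      gcongr
      rw [div_le_one hκ0]; exact hκ
    _ = _ := mul_one _

/-- The relative first-order correction to the reciprocal of the inner mass. -/
def massCorrection (y : ℝ) : ℝ := -(2 / 3) * (1 + y ^ 2) * mills y + y + 2 / 3 * y ^ 3

/-- Says that `massCorrection` is −(2/3) times the ratio of the third moment to the zeroth, since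
1/`gaussMoment 0 y` is 2·`mills y`. -/
theorem mills_mul_gaussMoment_three (y : ℝ) :
    2 * mills y * massCorrection y = -(2 / 3) * gaussMoment 3 y * (2 * mills y) ^ 2 := by
  have h : mills y * gaussMoment 0 y = 1 / 2 := by
    rw [mills_eq]; have := gaussMoment_zero_pos y; field_simp
  rw [gaussMoment_three, massCorrection]
  linear_combination (-(8 / 3) * mills y * ((1 + y ^ 2) * y + y / 2)) * h

/-- From the identity 1/W = 1/I − (W−I)/I² + (W−I)²/(I²W). As W ≥ I, the last 1/W may be replaced by
1/I. -/
theorem inv_expansion {I W e₁ A B : ℝ} (hI : 0 < I) (hW : I ≤ W) (h1 : |W - I - e₁| ≤ A)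
    (h2 : W - I ≤ B) : |1 / W - (1 / I - e₁ * (1 / I) ^ 2)| ≤ A * (1 / I) ^ 2 + B ^ 2 * (1 / I) ^ 3 := by
  have hW0 : 0 < W := lt_of_lt_of_le hI hW
  have heq : 1 / W - (1 / I - e₁ * (1 / I) ^ 2)
      = (W - I) ^ 2 * (1 / I) ^ 2 * (1 / W) - (W - I - e₁) * (1 / I) ^ 2 := by
    field_simp; ring
  have h3 : (W - I) ^ 2 ≤ B ^ 2 := by
    have : 0 ≤ W - I := by linarith
    gcongr
  have h4 : 1 / W ≤ 1 / I := by gcongr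
  have h5 : (W - I) ^ 2 * (1 / I) ^ 2 * (1 / W) ≤ B ^ 2 * (1 / I) ^ 3 := by
    calc _ ≤ B ^ 2 * (1 / I) ^ 2 * (1 / I) := by gcongr
      _ = _ := by ring
  rw [heq]
  refine (abs_sub _ _).trans ?_
  rw [abs_mul (W - I - e₁), abs_of_nonneg (show 0 ≤ (1 / I) ^ 2 by positivity),
    abs_of_nonneg (show 0 ≤ (W - I) ^ 2 * (1 / I) ^ 2 * (1 / W) by positivity), add_comm]
  gcongr

theorem inv_mass_le {κ L y : ℝ} (hκ : 0 < κ) (hy : -(κ / 2) < y) :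
    1 / (innerMass κ y + outerMass κ L y) ≤ 2 * mills y := by
  have h0 := gaussMoment_zero_pos y
  have h1 := gaussMoment_zero_le_innerMass hκ hy
  have h2 := outerMass_nonneg κ L y
  rw [mills_eq, mul_one_div, mul_comm 2, ← div_div, div_right_comm, div_self two_ne_zero]
  gcongr
  linarith

theorem mass_pos {κ L y : ℝ} (hκ : 0 < κ) (hy : -(κ / 2) < y) :
    0 < innerMass κ y + outerMass κ L y := by
  have h0 := gaussMoment_zero_pos y
  have h1 := gaussMoment_zero_le_innerMass hκ hy
  have h2 := outerMass_nonneg κ L y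
  linarith

/-- With m = min(y, 0), the mass errors carry e^{5m²/4} and `mills` carries e^{−m²}. The two
remainders of `inv_expansion` then have Gaussian exponents 5/4 − 2 = −3/4 and 5/2 − 3 = −1/2, both
covered by e^{−m²/2}. -/
theorem exists_inv_mass_expansion {l : ℝ} (hl : 0 < l) : ∃ C : ℝ, 0 < C ∧ ∀ κ y : ℝ, 1 ≤ κ →
    -(κ / 40) ≤ y → y ≤ κ * l / 4 →
    |1 / (innerMass κ y + outerMass κ (κ * l) y) - 2 * mills y * (1 + massCorrection y / κ)| ≤
      C / κ ^ 2 * ((1 + |y|) ^ 3 * Real.exp (-((min y 0) ^ 2 / 2))) := by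
  obtain ⟨C₀, hC₀, hmass⟩ := exists_innerMass_sub_le
  set K := C₀ + 4 / l ^ 3 with hK
  have hK0 : 0 < K := by positivity
  set E := Real.exp 3 with hE
  have hE0 : 0 < E := Real.exp_pos _
  refine ⟨K * (2 * E) ^ 2 + K ^ 2 * (2 * E) ^ 3, by positivity, fun κ y hκ hy hy' => ?_⟩
  have hκ0 : 0 < κ := by linarith
  obtain ⟨hm1, hm2⟩ := hmass κ y hκ hy
  have hT0 := outerMass_nonneg κ (κ * l) y
  have hT := outerMass_le hκ hl hy'
  have hI := gaussMoment_zero_pos y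
  have hD := gaussMoment_zero_le_innerMass hκ0 (y := y) (by linarith)
  set m := min y 0 with hm
  set M := Real.exp (5 / 4 * m ^ 2) with hM
  have hM1 : 1 ≤ M := Real.one_le_exp (by positivity)
  set W := innerMass κ y + outerMass κ (κ * l) y with hW
  have hT2 : outerMass κ (κ * l) y ≤ 4 / l ^ 3 / κ ^ 2 * M :=
    hT.trans (le_mul_of_one_le_right (by positivity) hM1)
  have hT1 : outerMass κ (κ * l) y ≤ 4 / l ^ 3 / κ * M := by
    refine hT2.trans ?_
    gcongr
    nlinarith
  have hA : |W - gaussMoment 0 y - 2 / (3 * κ) * gaussMoment 3 y| ≤ K / κ ^ 2 * M := by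
    rw [hW, hK, add_div, add_mul]
    rw [abs_le] at hm2 ⊢
    constructor <;> linarith [hm2.1, hm2.2]
  have hB : W - gaussMoment 0 y ≤ K / κ * M := by
    rw [hW, hK, add_div, add_mul]; linarith
  have hexp := inv_expansion hI (W := W) (by linarith) hA hB
  have hinv : 1 / gaussMoment 0 y = 2 * mills y := by
    rw [mills_eq]; field_simp
  rw [hinv] at hexp
  have heq : 2 * mills y - 2 / (3 * κ) * gaussMoment 3 y * (2 * mills y) ^ 2
      = 2 * mills y * (1 + massCorrection y / κ) := by
    have := mills_mul_gaussMoment_three y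
    rw [mul_add, mul_one, mul_div_assoc', this]
    field_simp; ring
  rw [heq] at hexp
  refine hexp.trans ?_
  have hmills0 := mills_pos y
  have hmills : 2 * mills y ≤ 2 * E * (1 + |y|) * Real.exp (-m ^ 2) := by
    have := mills_le y
    rw [← hm, ← hE] at this
    linarith
  have h1y : 1 ≤ 1 + |y| := by linarith [abs_nonneg y]
  have t1 : K / κ ^ 2 * M * (2 * mills y) ^ 2 ≤
      K * (2 * E) ^ 2 / κ ^ 2 * ((1 + |y|) ^ 3 * Real.exp (-(m ^ 2 / 2))) := by
    calc _ ≤ K / κ ^ 2 * M * (2 * E * (1 + |y|) * Real.exp (-m ^ 2)) ^ 2 := by gcongr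
      _ = K * (2 * E) ^ 2 / κ ^ 2 * ((1 + |y|) ^ 2 * (M * Real.exp (-m ^ 2) ^ 2)) := by ring
      _ ≤ _ := by
        gcongr
        · norm_num
        · rw [hM, ← Real.exp_nat_mul, ← Real.exp_add]
          refine Real.exp_le_exp.2 ?_
          push_cast
          nlinarith [sq_nonneg m]
  have t2 : (K / κ * M) ^ 2 * (2 * mills y) ^ 3 ≤
      K ^ 2 * (2 * E) ^ 3 / κ ^ 2 * ((1 + |y|) ^ 3 * Real.exp (-(m ^ 2 / 2))) := by
    calc _ ≤ (K / κ * M) ^ 2 * (2 * E * (1 + |y|) * Real.exp (-m ^ 2)) ^ 3 := by gcongr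
      _ = K ^ 2 * (2 * E) ^ 3 / κ ^ 2 * ((1 + |y|) ^ 3 * (M ^ 2 * Real.exp (-m ^ 2) ^ 3)) := by ring
      _ ≤ _ := by
        gcongr
        rw [hM, ← Real.exp_nat_mul, ← Real.exp_nat_mul, ← Real.exp_add]
        refine Real.exp_le_exp.2 ?_
        push_cast
        nlinarith [sq_nonneg m]
  exact (add_le_add t1 t2).trans (le_of_eq (by ring))

/-! ### Expansion of the factors contributed by the two edge points. -/

/-- The rescaled logarithmic distance of `edgePoint` from the hard wall. -/
def edgeShift (b κ s : ℝ) : ℝ := -(b * κ * Real.log (1 - s / (b * κ)))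

/-- The logarithm of the factor that an edge point contributes to each term of the kernel. -/
def edgePhase (b κ s y : ℝ) : ℝ :=
  edgeShift b κ s / (b * κ) - y * edgeShift b κ s - innerPhase κ (edgeShift b κ s) / 2

/-- The first-order correction to `edgePhase`. -/
def edgeCorrection (b s y : ℝ) : ℝ := s / b - y * s ^ 2 / (2 * b) + (1 / 3 - 1 / (2 * b)) * s ^ 3

theorem exists_edgeShift_expansion {b s : ℝ} (hb : 0 < b) (hs : 0 < s) :
    ∃ C κ₀ : ℝ, 0 < C ∧ 1 ≤ κ₀ ∧ ∀ κ, κ₀ ≤ κ → s ≤ edgeShift b κ s ∧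
      edgeShift b κ s ≤ s + C / κ ∧ edgeShift b κ s ≤ s + 1 ∧
      |edgeShift b κ s - s - s ^ 2 / (2 * b * κ)| ≤ C / κ ^ 2 := by
  set C₁ := 2 * s ^ 3 / b ^ 2 with hC₁
  set C := C₁ + s ^ 2 / (2 * b) with hC
  have hC₁0 : 0 < C₁ := by positivity
  have hC0 : 0 < C := by positivity
  -- 2s/b makes the argument s/(bκ) of the logarithmic series at most 1/2; C makes the shift at most
  -- s + 1.
  refine ⟨C, max (max 1 (2 * s / b)) C, hC0, (le_max_left _ _).trans (le_max_left _ _),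
    fun κ hκ => ?_⟩
  have hκ1 : 1 ≤ κ := ((le_max_left _ _).trans (le_max_left _ _)).trans hκ
  have hκ2 : 2 * s / b ≤ κ := ((le_max_right _ _).trans (le_max_left _ _)).trans hκ
  have hκ3 : C ≤ κ := (le_max_right _ _).trans hκ
  have hκ0 : 0 < κ := by linarith
  set x := s / (b * κ) with hx
  have hx0 : 0 < x := by positivity
  have hx2 : x ≤ 1 / 2 := by
    rw [div_le_iff₀ hb] at hκ2
    rw [hx, div_le_iff₀ (by positivity)]
    linarith
  have hlog := Real.abs_log_sub_add_sum_range_le (x := x) (by rw [abs_of_pos hx0]; linarith) 2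
  rw [abs_of_pos hx0, show 2 + 1 = 3 from rfl] at hlog
  have hlog2 : |x + x ^ 2 / 2 + Real.log (1 - x)| ≤ 2 * x ^ 3 := by
    have h1 : x ^ 3 / (1 - x) ≤ 2 * x ^ 3 := by
      rw [div_le_iff₀ (by linarith)]
      nlinarith [mul_nonneg (pow_nonneg hx0.le 3) (show 0 ≤ 1 - 2 * x by linarith)]
    refine le_trans (le_of_eq ?_) (hlog.trans h1)
    congr 1
    norm_num [Finset.sum_range_succ]
  have hbk : 0 < b * κ := by positivity
  have hbx : b * κ * x = s := by rw [hx]; field_simp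
  have hd : |edgeShift b κ s - s - s ^ 2 / (2 * b * κ)| ≤ C₁ / κ ^ 2 := by
    have heq : edgeShift b κ s - s - s ^ 2 / (2 * b * κ)
        = -(b * κ * (x + x ^ 2 / 2 + Real.log (1 - x))) := by
      rw [edgeShift, ← hx]
      have : s ^ 2 / (2 * b * κ) = b * κ * (x ^ 2 / 2) := by rw [hx]; field_simp
      rw [this]
      linear_combination hbx
    rw [heq, abs_neg, abs_mul, abs_of_pos hbk]
    refine (mul_le_mul_of_nonneg_left hlog2 hbk.le).trans (le_of_eq ?_)
    rw [hx, hC₁]; field_simp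
  have hCle : C₁ / κ ^ 2 ≤ C₁ / κ := by
    gcongr
    nlinarith
  have hup : edgeShift b κ s ≤ s + C / κ := by
    have h1 := (abs_le.1 hd).2
    have h2 : s ^ 2 / (2 * b * κ) = s ^ 2 / (2 * b) / κ := by field_simp
    rw [hC, add_div]
    linarith
  refine ⟨?_, hup, ?_, hd.trans ?_⟩
  · have := Real.log_le_sub_one_of_pos (show 0 < 1 - x by linarith)
    rw [edgeShift, ← hx]
    nlinarith
  · have : C / κ ≤ 1 := by rw [div_le_one hκ0]; exact hκ3
    linarith
  · gcongr
    rw [hC]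
    have : 0 < s ^ 2 / (2 * b) := by positivity
    linarith

/-- The crude first bound serves the far indices. Its extra −min(y, 0) arises because the shift lies
between s and s + 1, so that for negative y the product −y·shift can exceed −sy by |y|. -/
theorem exists_edgePhase_expansion {b s : ℝ} (hb : 0 < b) (hs : 0 < s) :
    ∃ C κ₀ : ℝ, 0 < C ∧ 1 ≤ κ₀ ∧ ∀ κ y, κ₀ ≤ κ →
      edgePhase b κ s y ≤ C - s * y - min y 0 ∧
      |edgePhase b κ s y - (-(s * y) - s ^ 2 / 2 + edgeCorrection b s y / κ)| ≤
        C * (1 + |y|) / κ ^ 2 := by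
  obtain ⟨C, κ₀, hC, hκ₀, h⟩ := exists_edgeShift_expansion hb hs
  set K := C / b + C + s * C + C ^ 2 / 2 + C * (s + 1) ^ 2 + (s + 1) ^ 4 / 6 with hK
  have hK0 : 0 < K := by positivity
  refine ⟨K + (s + 1) / b, κ₀, by positivity, hκ₀, fun κ y hκ => ?_⟩
  obtain ⟨hu1, hu2, hu3, hd⟩ := h κ hκ
  have hκ1 : 1 ≤ κ := hκ₀.trans hκ
  have hκ0 : 0 < κ := by linarith
  set u := edgeShift b κ s with hu
  have hu0 : 0 < u := by linarith
  constructor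
  · have hP : 0 ≤ innerPhase κ u := by
      unfold innerPhase
      exact mul_nonneg (by positivity) (expRem_neg_nonneg _)
    have h1 : u / (b * κ) ≤ (s + 1) / b := by
      gcongr
      nlinarith
    have h2 : -(y * u) ≤ -(s * y) - min y 0 := by
      rcases le_total y 0 with hy | hy
      · rw [min_eq_left hy]; nlinarith
      · rw [min_eq_right hy]; nlinarith
    rw [edgePhase, ← hu]
    linarith
  · set d := u - s - s ^ 2 / (2 * b * κ) with hd'
    set e := u - s with he
    set r := innerPhase κ u - (u ^ 2 - 2 / 3 * u ^ 3 / κ) with hr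
    have he0 : 0 ≤ e := by linarith
    have he1 : e ≤ C / κ := by linarith
    have hr0 : 0 ≤ r := by have := le_innerPhase hκ0 hu0.le; linarith
    have hr1 : r ≤ (s + 1) ^ 4 / 3 / κ ^ 2 := by
      have h1 := innerPhase_le_quartic hκ0 hu0.le
      have h2 : u ^ 4 / (3 * κ ^ 2) ≤ (s + 1) ^ 4 / (3 * κ ^ 2) := by gcongr
      rw [div_div]; linarith
    -- The s³ coefficient has two sources: u³/(3κ) from the cubic part of the phase gives 1/3, and
    -- −u²/2 with u ≈ s + s²/(2bκ) gives −1/(2b).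
    have heq : edgePhase b κ s y - (-(s * y) - s ^ 2 / 2 + edgeCorrection b s y / κ)
        = e / (b * κ) - y * d - s * d - e ^ 2 / 2 + e * (u ^ 2 + u * s + s ^ 2) / (3 * κ) - r / 2 := by
      rw [edgePhase, ← hu, edgeCorrection, hr, hd', he]
      field_simp
      ring
    have t1 : |e / (b * κ)| ≤ C / b / κ ^ 2 := by
      rw [abs_of_nonneg (by positivity)]
      calc e / (b * κ) ≤ C / κ / (b * κ) := by gcongr
        _ = _ := by field_simp
    have t2 : |y * d| ≤ C * |y| / κ ^ 2 := by
      rw [abs_mul]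
      calc |y| * |d| ≤ |y| * (C / κ ^ 2) := by gcongr
        _ = _ := by ring
    have t3 : |s * d| ≤ s * C / κ ^ 2 := by
      rw [abs_mul, abs_of_pos hs]
      calc s * |d| ≤ s * (C / κ ^ 2) := by gcongr
        _ = _ := by ring
    have t4 : |e ^ 2 / 2| ≤ C ^ 2 / 2 / κ ^ 2 := by
      rw [abs_of_nonneg (by positivity)]
      calc e ^ 2 / 2 ≤ (C / κ) ^ 2 / 2 := by gcongr
        _ = _ := by ring
    have t5 : |e * (u ^ 2 + u * s + s ^ 2) / (3 * κ)| ≤ C * (s + 1) ^ 2 / κ ^ 2 := by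
      rw [abs_of_nonneg (by positivity)]
      have h1 : u ^ 2 + u * s + s ^ 2 ≤ 3 * (s + 1) ^ 2 := by nlinarith
      calc e * (u ^ 2 + u * s + s ^ 2) / (3 * κ) ≤ C / κ * (3 * (s + 1) ^ 2) / (3 * κ) := by gcongr
        _ = _ := by field_simp
    have t6 : |r / 2| ≤ (s + 1) ^ 4 / 6 / κ ^ 2 := by
      rw [abs_of_nonneg (by positivity)]
      calc r / 2 ≤ (s + 1) ^ 4 / 3 / κ ^ 2 / 2 := by gcongr
        _ = _ := by ring
    rw [heq]
    have hfin : C / b / κ ^ 2 + C * |y| / κ ^ 2 + s * C / κ ^ 2 + C ^ 2 / 2 / κ ^ 2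
        + C * (s + 1) ^ 2 / κ ^ 2 + (s + 1) ^ 4 / 6 / κ ^ 2 ≤
        (K + (s + 1) / b) * (1 + |y|) / κ ^ 2 := by
      rw [← add_div, ← add_div, ← add_div, ← add_div, ← add_div]
      gcongr
      have h1 : C / b + C * |y| + s * C + C ^ 2 / 2 + C * (s + 1) ^ 2 + (s + 1) ^ 4 / 6 ≤
          K * (1 + |y|) := by
        have p1 : 0 ≤ (C / b + s * C + C ^ 2 / 2 + C * (s + 1) ^ 2 + (s + 1) ^ 4 / 6) * |y| := by
          positivity
        have p2 : K * (1 + |y|) = K + C * |y|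
          + (C / b + s * C + C ^ 2 / 2 + C * (s + 1) ^ 2 + (s + 1) ^ 4 / 6) * |y| := by
          rw [hK]; ring
        linarith
      have h2 : 0 ≤ (s + 1) / b * (1 + |y|) := by positivity
      rw [add_mul]
      linarith
    refine le_trans ?_ hfin
    refine (abs_sub _ _).trans (add_le_add ((abs_add_le _ _).trans (add_le_add ?_ t5)) t6)
    refine (abs_sub _ _).trans (add_le_add ((abs_sub _ _).trans (add_le_add ?_ t3)) t4)
    exact (abs_sub _ _).trans (add_le_add t1 t2)

theorem abs_edgeCorrection_le (b s : ℝ) :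
    ∃ C : ℝ, 0 < C ∧ ∀ y, |edgeCorrection b s y| ≤ C * (1 + |y|) := by
  refine ⟨|s / b| + |s ^ 2 / (2 * b)| + |(1 / 3 - 1 / (2 * b)) * s ^ 3| + 1, by positivity,
    fun y => ?_⟩
  have h : edgeCorrection b s y = s / b - y * (s ^ 2 / (2 * b)) + (1 / 3 - 1 / (2 * b)) * s ^ 3 := by
    rw [edgeCorrection]; ring
  rw [h]
  refine (abs_add_le _ _).trans ?_
  refine (add_le_add_left (abs_sub _ _) _).trans ?_
  rw [abs_mul y]
  have := abs_nonneg y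
  have p1 := mul_nonneg (abs_nonneg (s / b)) this
  have p2 := mul_nonneg (abs_nonneg ((1 / 3 - 1 / (2 * b)) * s ^ 3)) this
  have p3 := abs_nonneg (s ^ 2 / (2 * b))
  nlinarith

/-- The restriction |y| ≤ κ keeps the deviation of the exponent from its limit bounded, so the
exponential can be linearised with a uniform constant. The crude bound needs no such restriction. -/
theorem exists_exp_edgePhase_expansion {b s₁ s₂ : ℝ} (hb : 0 < b) (hs₁ : 0 < s₁) (hs₂ : 0 < s₂) :
    ∃ C κ₀ : ℝ, 0 < C ∧ 1 ≤ κ₀ ∧ ∀ κ y, κ₀ ≤ κ →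
      Real.exp (edgePhase b κ s₁ y + edgePhase b κ s₂ y) ≤
        C * Real.exp (-((s₁ + s₂) * y) - 2 * min y 0) ∧
      (|y| ≤ κ → |Real.exp (edgePhase b κ s₁ y + edgePhase b κ s₂ y)
        - Real.exp (-((s₁ + s₂) * y) - (s₁ ^ 2 + s₂ ^ 2) / 2)
          * (1 + (edgeCorrection b s₁ y + edgeCorrection b s₂ y) / κ)| ≤
        C * (1 + |y|) ^ 2 / κ ^ 2 * Real.exp (-((s₁ + s₂) * y))) := by
  obtain ⟨C₁, k₁, hC₁, hk₁, h₁⟩ := exists_edgePhase_expansion hb hs₁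
  obtain ⟨C₂, k₂, hC₂, hk₂, h₂⟩ := exists_edgePhase_expansion hb hs₂
  obtain ⟨A₁, hA₁, ha₁⟩ := abs_edgeCorrection_le b s₁
  obtain ⟨A₂, hA₂, ha₂⟩ := abs_edgeCorrection_le b s₂
  set K := C₁ + C₂ + A₁ + A₂ with hK
  have hK0 : 0 < K := by positivity
  refine ⟨K ^ 2 * Real.exp (2 * K) + K + Real.exp (C₁ + C₂), max k₁ k₂, by positivity,
    hk₁.trans (le_max_left _ _), fun κ y hκ => ?_⟩
  obtain ⟨hu₁, he₁⟩ := h₁ κ y ((le_max_left _ _).trans hκ)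
  obtain ⟨hu₂, he₂⟩ := h₂ κ y ((le_max_right _ _).trans hκ)
  have hκ1 : 1 ≤ κ := (hk₁.trans (le_max_left _ _)).trans hκ
  have hκ0 : 0 < κ := by linarith
  constructor
  · calc _ ≤ Real.exp (C₁ + C₂ + (-((s₁ + s₂) * y) - 2 * min y 0)) := by
          refine Real.exp_le_exp.2 ?_; linarith
      _ = Real.exp (C₁ + C₂) * Real.exp (-((s₁ + s₂) * y) - 2 * min y 0) := Real.exp_add _ _
      _ ≤ _ := by
        gcongr
        have : 0 < K ^ 2 * Real.exp (2 * K) := by positivity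
        linarith
  · intro hy
    set S := edgePhase b κ s₁ y + edgePhase b κ s₂ y with hS
    set S₀ := -((s₁ + s₂) * y) - (s₁ ^ 2 + s₂ ^ 2) / 2 with hS₀
    set c := edgeCorrection b s₁ y + edgeCorrection b s₂ y with hc
    have hy0 := abs_nonneg y
    have hr : |S - S₀ - c / κ| ≤ (C₁ + C₂) * (1 + |y|) / κ ^ 2 := by
      have heq : S - S₀ - c / κ
        = (edgePhase b κ s₁ y - (-(s₁ * y) - s₁ ^ 2 / 2 + edgeCorrection b s₁ y / κ))
        + (edgePhase b κ s₂ y - (-(s₂ * y) - s₂ ^ 2 / 2 + edgeCorrection b s₂ y / κ)) := by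
        rw [hS, hS₀, hc]; ring
      rw [heq]
      refine (abs_add_le _ _).trans ((add_le_add he₁ he₂).trans (le_of_eq (by ring)))
    have hcb : |c| ≤ (A₁ + A₂) * (1 + |y|) := by
      refine (abs_add_le _ _).trans ((add_le_add (ha₁ y) (ha₂ y)).trans (le_of_eq (by ring)))
    have hx : |S - S₀| ≤ K * (1 + |y|) / κ := by
      have h1 : |c / κ| ≤ (A₁ + A₂) * (1 + |y|) / κ := by
        rw [abs_div, abs_of_pos hκ0]; gcongr
      have h2 : (C₁ + C₂) * (1 + |y|) / κ ^ 2 ≤ (C₁ + C₂) * (1 + |y|) / κ := by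
        gcongr
        nlinarith
      have h3 : |S - S₀| ≤ |S - S₀ - c / κ| + |c / κ| := by
        have := abs_add_le (S - S₀ - c / κ) (c / κ)
        simpa using this
      have h4 : K * (1 + |y|) / κ = (C₁ + C₂) * (1 + |y|) / κ + (A₁ + A₂) * (1 + |y|) / κ := by
        rw [hK]; ring
      linarith
    have hx2 : |S - S₀| ≤ 2 * K := by
      refine hx.trans ?_
      rw [div_le_iff₀ hκ0]
      nlinarith
    -- The deviation may have either sign; the two-sided bound comes from the complex exponential
    -- series.
    have hexp : |Real.exp (S - S₀) - 1 - (S - S₀)| ≤ |S - S₀| ^ 2 * Real.exp |S - S₀| := by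
      have := Complex.norm_exp_sub_sum_le_norm_mul_exp ((S - S₀ : ℝ) : ℂ) 2
      simp only [Finset.sum_range_succ, Finset.sum_range_zero, pow_zero, pow_one,
        Nat.factorial, zero_add] at this
      norm_num at this
      rw [← Complex.ofReal_sub, ← Complex.ofReal_exp, ← Complex.ofReal_one, ← Complex.ofReal_add,
        ← Complex.ofReal_sub, Complex.norm_real, Complex.norm_real, Real.norm_eq_abs,
        Real.norm_eq_abs] at this
      rw [sub_sub]
      simpa using this
    have hmain : |Real.exp (S - S₀) - (1 + c / κ)| ≤
        (K ^ 2 * Real.exp (2 * K) + K) * (1 + |y|) ^ 2 / κ ^ 2 := by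
      have h1 : |S - S₀| ^ 2 * Real.exp |S - S₀| ≤ (K * (1 + |y|) / κ) ^ 2 * Real.exp (2 * K) := by
        gcongr
      have h2 : (C₁ + C₂) * (1 + |y|) / κ ^ 2 ≤ K * (1 + |y|) ^ 2 / κ ^ 2 := by
        gcongr
        · linarith
        · nlinarith
      have heq : Real.exp (S - S₀) - (1 + c / κ)
          = (Real.exp (S - S₀) - 1 - (S - S₀)) + (S - S₀ - c / κ) := by ring
      rw [heq]
      refine (abs_add_le _ _).trans ((add_le_add (hexp.trans h1) (hr.trans h2)).trans (le_of_eq ?_))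
      ring
    have hfac : Real.exp S - Real.exp S₀ * (1 + c / κ)
        = Real.exp S₀ * (Real.exp (S - S₀) - (1 + c / κ)) := by
      rw [mul_sub, ← Real.exp_add]; congr 2; ring
    rw [hfac, abs_mul, abs_of_pos (Real.exp_pos _), mul_comm]
    have hS₀le : Real.exp S₀ ≤ Real.exp (-((s₁ + s₂) * y)) := by
      refine Real.exp_le_exp.2 ?_
      have : 0 ≤ (s₁ ^ 2 + s₂ ^ 2) / 2 := by positivity
      linarith
    have hpos : 0 < Real.exp (C₁ + C₂) := Real.exp_pos _
    refine mul_le_mul (hmain.trans ?_) hS₀le (Real.exp_pos _).le (by positivity)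
    exact div_le_div_of_nonneg_right (mul_le_mul_of_nonneg_right (by linarith) (by positivity))
      (by positivity)

/-! ### Decay classes and the uniform expansion of one kernel term. -/

theorem profile_eq (s₁ s₂ y : ℝ) : profile s₁ s₂ y =
    mills y * Real.exp (-((s₁ + s₂) * y) - (s₁ ^ 2 + s₂ ^ 2) / 2) := by
  rw [profile, mills, div_mul_eq_mul_div, ← Real.exp_add]
  congr 2; ring

/-- The relative first-order correction to a term of the kernel. -/
def termCorrection (b s₁ s₂ y : ℝ) : ℝ :=
  edgeCorrection b s₁ y + edgeCorrection b s₂ y + massCorrection y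

/-- The weight that controls all error terms. -/
def errorWeight (σ : ℝ) (k : ℕ) (y : ℝ) : ℝ :=
  (1 + |y|) ^ k * Real.exp (-((min y 0) ^ 2 / 2)) * Real.exp (-(σ * y))

/-- Here σ > 0, that is, a positive distance from the wall, provides the decay at +∞. At −∞ the
Gaussian beats the growing e^{−σy}. Half of the rate pays for the polynomial factor. -/
theorem exists_errorWeight_le {σ : ℝ} (hσ : 0 < σ) (k : ℕ) :
    ∃ C : ℝ, 0 < C ∧ ∀ y, errorWeight σ k y ≤ C * Real.exp (-(σ / 2 * |y|)) := by
  refine ⟨(k.factorial / (σ / 2) ^ k * Real.exp (σ / 2)) * Real.exp (2 * σ ^ 2), by positivity,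
    fun y => ?_⟩
  have h1 : (1 + |y|) ^ k ≤ k.factorial / (σ / 2) ^ k * Real.exp (σ / 2) * Real.exp (σ / 2 * |y|) := by
    have := Real.pow_div_factorial_le_exp (x := σ / 2 * (1 + |y|)) (by positivity) k
    rw [mul_pow, div_le_iff₀ (by positivity), mul_add, mul_one, Real.exp_add] at this
    rw [div_mul_eq_mul_div, div_mul_eq_mul_div, le_div_iff₀ (by positivity)]
    linarith
  have h2 : Real.exp (-((min y 0) ^ 2 / 2)) * Real.exp (-(σ * y)) ≤
      Real.exp (2 * σ ^ 2) * Real.exp (-(σ * |y|)) := by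
    rw [← Real.exp_add, ← Real.exp_add]
    refine Real.exp_le_exp.2 ?_
    rcases le_total y 0 with hy | hy
    · rw [min_eq_left hy, abs_of_nonpos hy]
      nlinarith [sq_nonneg (y + 2 * σ)]
    · rw [min_eq_right hy, abs_of_nonneg hy]
      nlinarith [sq_nonneg σ]
  rw [errorWeight, mul_assoc]
  calc _ ≤ (k.factorial / (σ / 2) ^ k * Real.exp (σ / 2) * Real.exp (σ / 2 * |y|)) *
        (Real.exp (2 * σ ^ 2) * Real.exp (-(σ * |y|))) := by gcongr
    _ = (k.factorial / (σ / 2) ^ k * Real.exp (σ / 2)) * Real.exp (2 * σ ^ 2) *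
        (Real.exp (σ / 2 * |y|) * Real.exp (-(σ * |y|))) := by ring
    _ = _ := by rw [← Real.exp_add]; congr 2; ring

/-- Functions bounded by a power of `1 + |y|`. -/
def PolyGrowth (g : ℝ → ℝ) : Prop := ∃ (C : ℝ) (k : ℕ), 0 < C ∧ ∀ y, |g y| ≤ C * (1 + |y|) ^ k

/-- Functions with exponential decay at both ends of the line. -/
def ExpDecay (f : ℝ → ℝ) : Prop :=
  ∃ C c : ℝ, 0 < C ∧ 0 < c ∧ ∀ y, |f y| ≤ C * Real.exp (-(c * |y|))

theorem PolyGrowth.const (a : ℝ) : PolyGrowth fun _ => a :=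
  ⟨|a| + 1, 0, by positivity, fun y => by simp⟩

theorem PolyGrowth.id : PolyGrowth fun y => y :=
  ⟨1, 1, one_pos, fun y => by simp⟩

theorem PolyGrowth.mul {f g : ℝ → ℝ} (hf : PolyGrowth f) (hg : PolyGrowth g) :
    PolyGrowth fun y => f y * g y := by
  obtain ⟨C, k, hC, h⟩ := hf
  obtain ⟨D, l, hD, h'⟩ := hg
  refine ⟨C * D, k + l, by positivity, fun y => ?_⟩
  rw [abs_mul]
  calc |f y| * |g y| ≤ (C * (1 + |y|) ^ k) * (D * (1 + |y|) ^ l) := by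
        gcongr
        · exact h y
        · exact h' y
    _ = _ := by ring

theorem PolyGrowth.add {f g : ℝ → ℝ} (hf : PolyGrowth f) (hg : PolyGrowth g) :
    PolyGrowth fun y => f y + g y := by
  obtain ⟨C, k, hC, h⟩ := hf
  obtain ⟨D, l, hD, h'⟩ := hg
  refine ⟨C + D, k + l, by positivity, fun y => ?_⟩
  have h1 : 1 ≤ 1 + |y| := by linarith [abs_nonneg y]
  have hk : (1 + |y|) ^ k ≤ (1 + |y|) ^ (k + l) := pow_le_pow_right₀ h1 (by omega)
  have hl : (1 + |y|) ^ l ≤ (1 + |y|) ^ (k + l) := pow_le_pow_right₀ h1 (by omega)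
  calc |f y + g y| ≤ C * (1 + |y|) ^ k + D * (1 + |y|) ^ l :=
        (abs_add_le _ _).trans (add_le_add (h y) (h' y))
    _ ≤ C * (1 + |y|) ^ (k + l) + D * (1 + |y|) ^ (k + l) := by gcongr
    _ = _ := by ring

theorem PolyGrowth.sub {f g : ℝ → ℝ} (hf : PolyGrowth f) (hg : PolyGrowth g) :
    PolyGrowth fun y => f y - g y := by
  have := hf.add ((PolyGrowth.const (-1)).mul hg)
  refine (funext fun y => ?_ : (fun y => f y - g y) = _) ▸ this
  ring

theorem PolyGrowth.pow {f : ℝ → ℝ} (hf : PolyGrowth f) (k : ℕ) : PolyGrowth fun y => f y ^ k := by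
  induction k with
  | zero => simpa using PolyGrowth.const 1
  | succ k ih => simpa only [pow_succ] using ih.mul hf

theorem mills_le' (y : ℝ) : mills y ≤ Real.exp 3 * (1 + |y|) := by
  refine (mills_le y).trans (mul_le_of_le_one_right (by positivity) ?_)
  rw [Real.exp_le_one_iff]
  have := sq_nonneg (min y 0)
  linarith

theorem polyGrowth_mills : PolyGrowth mills :=
  ⟨Real.exp 3, 1, Real.exp_pos _, fun y => by
    rw [abs_of_pos (mills_pos y), pow_one]; exact mills_le' y⟩

theorem polyGrowth_massCorrection : PolyGrowth massCorrection := by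
  unfold massCorrection
  have h1 : PolyGrowth fun y => -(2 / 3) * (1 + y ^ 2) * mills y :=
    ((PolyGrowth.const _).mul ((PolyGrowth.const _).add (PolyGrowth.id.pow 2))).mul polyGrowth_mills
  have h2 : PolyGrowth fun y => 2 / 3 * y ^ 3 := (PolyGrowth.const _).mul (PolyGrowth.id.pow 3)
  exact (h1.add PolyGrowth.id).add h2

theorem polyGrowth_edgeCorrection (b s : ℝ) : PolyGrowth (edgeCorrection b s) := by
  obtain ⟨C, hC, h⟩ := abs_edgeCorrection_le b s
  exact ⟨C, 1, hC, fun y => by simpa using h y⟩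

theorem polyGrowth_termCorrection (b s₁ s₂ : ℝ) : PolyGrowth (termCorrection b s₁ s₂) :=
  ((polyGrowth_edgeCorrection b s₁).add (polyGrowth_edgeCorrection b s₂)).add
    polyGrowth_massCorrection

theorem profile_pos (s₁ s₂ y : ℝ) : 0 < profile s₁ s₂ y := by
  rw [profile_eq]; have := mills_pos y; positivity

theorem profile_mul_pow_le (s₁ s₂ y : ℝ) (k : ℕ) :
    profile s₁ s₂ y * (1 + |y|) ^ k ≤ Real.exp 3 * errorWeight (s₁ + s₂) (k + 1) y := by
  rw [profile_eq, errorWeight]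
  have h1 : Real.exp (-((s₁ + s₂) * y) - (s₁ ^ 2 + s₂ ^ 2) / 2) ≤ Real.exp (-((s₁ + s₂) * y)) := by
    refine Real.exp_le_exp.2 ?_
    have : 0 ≤ (s₁ ^ 2 + s₂ ^ 2) / 2 := by positivity
    linarith
  have h2 : Real.exp (-(min y 0) ^ 2) ≤ Real.exp (-((min y 0) ^ 2 / 2)) := by
    refine Real.exp_le_exp.2 ?_
    have := sq_nonneg (min y 0)
    linarith
  have h3 := mills_le y
  have h4 := mills_pos y
  calc _ ≤ Real.exp 3 * (1 + |y|) * Real.exp (-(min y 0) ^ 2) * Real.exp (-((s₁ + s₂) * y))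
        * (1 + |y|) ^ k := by gcongr
    _ ≤ Real.exp 3 * (1 + |y|) * Real.exp (-((min y 0) ^ 2 / 2)) * Real.exp (-((s₁ + s₂) * y))
        * (1 + |y|) ^ k := by gcongr
    _ = _ := by ring

theorem expDecay_profile_mul {s₁ s₂ : ℝ} (hσ : 0 < s₁ + s₂) {g : ℝ → ℝ} (hg : PolyGrowth g) :
    ExpDecay fun y => profile s₁ s₂ y * g y := by
  obtain ⟨C, k, hC, h⟩ := hg
  obtain ⟨D, hD, h'⟩ := exists_errorWeight_le hσ (k + 1)
  refine ⟨C * (Real.exp 3 * D), (s₁ + s₂) / 2, by positivity, by positivity, fun y => ?_⟩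
  have hp := profile_pos s₁ s₂ y
  rw [abs_mul, abs_of_pos hp]
  calc profile s₁ s₂ y * |g y| ≤ profile s₁ s₂ y * (C * (1 + |y|) ^ k) := by gcongr; exact h y
    _ = C * (profile s₁ s₂ y * (1 + |y|) ^ k) := by ring
    _ ≤ C * (Real.exp 3 * (D * Real.exp (-((s₁ + s₂) / 2 * |y|)))) := by
      refine mul_le_mul_of_nonneg_left ((profile_mul_pow_le s₁ s₂ y k).trans ?_) hC.le
      gcongr
      exact h' y
    _ = _ := by ring

theorem expDecay_profile {s₁ s₂ : ℝ} (hσ : 0 < s₁ + s₂) : ExpDecay (profile s₁ s₂) := by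
  simpa using expDecay_profile_mul hσ (PolyGrowth.const 1)

theorem errorWeight_mono (σ : ℝ) {k l : ℕ} (h : k ≤ l) (y : ℝ) :
    errorWeight σ k y ≤ errorWeight σ l y := by
  unfold errorWeight
  have h1 : 1 ≤ 1 + |y| := by linarith [abs_nonneg y]
  gcongr

theorem integrable_exp_neg_abs {c : ℝ} (hc : 0 < c) :
    Integrable fun y : ℝ => Real.exp (-(c * |y|)) := by
  have h1 : IntegrableOn (fun y : ℝ => Real.exp (-(c * |y|))) (Ioi 0) := by
    have := integrableOn_pow_mul_exp_neg 0 hc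
    refine this.congr_fun (fun y hy => ?_) measurableSet_Ioi
    rw [abs_of_pos hy]; simp
  have h2 : IntegrableOn (fun y : ℝ => Real.exp (-(c * |y|))) (Iic 0) := by
    have h3 := (integrableOn_exp_mul_Iic hc 0)
    refine h3.congr_fun (fun y hy => ?_) measurableSet_Iic
    rw [abs_of_nonpos hy]; simp
  have := h2.union h1
  rwa [Iic_union_Ioi, integrableOn_univ] at this

theorem ExpDecay.integrable {f : ℝ → ℝ} (hf : ExpDecay f) (hc : Continuous f) : Integrable f := by
  obtain ⟨C, c, hC, hc0, h⟩ := hf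
  exact ((integrable_exp_neg_abs hc0).const_mul C).mono' hc.aestronglyMeasurable
    (Eventually.of_forall h)

theorem exists_term_expansion_inner {b s₁ s₂ l : ℝ} (hb : 0 < b) (hs₁ : 0 < s₁) (hs₂ : 0 < s₂)
    (hl : 0 < l) : ∃ (C κ₀ : ℝ) (k : ℕ), 0 < C ∧ 1 ≤ κ₀ ∧ ∀ κ y, κ₀ ≤ κ → -(κ / 40) ≤ y →
      y ≤ κ * l / 4 → |y| ≤ κ →
      |Real.exp (edgePhase b κ s₁ y + edgePhase b κ s₂ y)
          / (innerMass κ y + outerMass κ (κ * l) y)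
        - 2 * profile s₁ s₂ y * (1 + termCorrection b s₁ s₂ y / κ)| ≤
      C / κ ^ 2 * errorWeight (s₁ + s₂) k y := by
  obtain ⟨K, κ₀, hK, hκ₀, hE⟩ := exists_exp_edgePhase_expansion hb hs₁ hs₂
  obtain ⟨D, hD, hV⟩ := exists_inv_mass_expansion hl
  obtain ⟨A, k, hA, hc⟩ := (polyGrowth_edgeCorrection b s₁).add (polyGrowth_edgeCorrection b s₂)
  obtain ⟨B, m, hB, hm⟩ := polyGrowth_massCorrection
  refine ⟨K * (2 * Real.exp 3) + (1 + A) * D + 2 * (A * B) * Real.exp 3, κ₀, k + m + 3,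
    by positivity, hκ₀, fun κ y hκ hy1 hy2 hy3 => ?_⟩
  have hκ1 : 1 ≤ κ := hκ₀.trans hκ
  have hκ0 : 0 < κ := by linarith
  have hE' := (hE κ y hκ).2 hy3
  have hV' := hV κ y hκ1 hy1 hy2
  have hc' := hc y
  have hm' := hm y
  have hp := profile_pos s₁ s₂ y
  have hlam := mills_pos y
  have hVle := inv_mass_le (L := κ * l) hκ0 (y := y) (by linarith)
  have hV0 : 0 ≤ 1 / (innerMass κ y + outerMass κ (κ * l) y) := by
    have := mass_pos (L := κ * l) hκ0 (y := y) (by linarith)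
    positivity
  have hpeq := profile_eq s₁ s₂ y
  rw [div_eq_mul_one_div]
  unfold termCorrection
  set σ := s₁ + s₂ with hσ
  set E := Real.exp (edgePhase b κ s₁ y + edgePhase b κ s₂ y) with hEd
  set V := 1 / (innerMass κ y + outerMass κ (κ * l) y) with hVd
  set c := edgeCorrection b s₁ y + edgeCorrection b s₂ y with hcd
  set χ := massCorrection y with hχ
  set p := profile s₁ s₂ y with hpd
  set E₀ := Real.exp (-(σ * y) - (s₁ ^ 2 + s₂ ^ 2) / 2) with hE₀
  have hy0 := abs_nonneg y
  have h1y : 1 ≤ 1 + |y| := by linarith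
  have hE₀le : E₀ ≤ Real.exp (-(σ * y)) := by
    refine Real.exp_le_exp.2 ?_
    have : 0 ≤ (s₁ ^ 2 + s₂ ^ 2) / 2 := by positivity
    linarith
  have hE₀0 : 0 < E₀ := Real.exp_pos _
  -- Both factors are replaced by their expansions one after the other; multiplying the two
  -- expansions leaves the cross term cχ/κ².
  have heq : E * V - 2 * p * (1 + (c + χ) / κ)
      = (E - E₀ * (1 + c / κ)) * V + E₀ * (1 + c / κ) * (V - 2 * mills y * (1 + χ / κ))
        + 2 * (p * (c * χ)) / κ ^ 2 := by
    rw [hpeq]; field_simp; ring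
  have t1 : |(E - E₀ * (1 + c / κ)) * V| ≤
      K * (2 * Real.exp 3) / κ ^ 2 * errorWeight σ (k + m + 3) y := by
    rw [abs_mul, abs_of_nonneg hV0]
    have h2 : Real.exp (-(min y 0) ^ 2) ≤ Real.exp (-((min y 0) ^ 2 / 2)) := by
      refine Real.exp_le_exp.2 ?_
      have := sq_nonneg (min y 0)
      linarith
    calc _ ≤ K * (1 + |y|) ^ 2 / κ ^ 2 * Real.exp (-(σ * y)) * (2 * mills y) := by gcongr
      _ ≤ K * (1 + |y|) ^ 2 / κ ^ 2 * Real.exp (-(σ * y)) *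
          (2 * (Real.exp 3 * (1 + |y|) * Real.exp (-((min y 0) ^ 2 / 2)))) := by
        gcongr
        exact (mills_le y).trans (by gcongr)
      _ = K * (2 * Real.exp 3) / κ ^ 2 * errorWeight σ 3 y := by rw [errorWeight]; ring
      _ ≤ _ := by gcongr; exact errorWeight_mono σ (by omega) y
  have t2 : |E₀ * (1 + c / κ) * (V - 2 * mills y * (1 + χ / κ))| ≤
      (1 + A) * D / κ ^ 2 * errorWeight σ (k + m + 3) y := by
    have h2 : |1 + c / κ| ≤ (1 + A) * (1 + |y|) ^ k := by
      have h3 : |c / κ| ≤ A * (1 + |y|) ^ k := by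
        rw [abs_div, abs_of_pos hκ0]
        refine (div_le_self (abs_nonneg _) hκ1).trans hc'
      have h4 : 1 ≤ (1 + |y|) ^ k := one_le_pow₀ h1y
      calc |1 + c / κ| ≤ |1| + |c / κ| := abs_add_le _ _
        _ ≤ _ := by rw [abs_one]; linarith
    rw [abs_mul, abs_mul, abs_of_pos hE₀0]
    calc _ ≤ Real.exp (-(σ * y)) * ((1 + A) * (1 + |y|) ^ k) *
          (D / κ ^ 2 * ((1 + |y|) ^ 3 * Real.exp (-((min y 0) ^ 2 / 2)))) := by gcongr
      _ = (1 + A) * D / κ ^ 2 * errorWeight σ (k + 3) y := by rw [errorWeight]; ring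
      _ ≤ _ := by gcongr; exact errorWeight_mono σ (by omega) y
  have t3 : |2 * (p * (c * χ)) / κ ^ 2| ≤
      2 * (A * B) * Real.exp 3 / κ ^ 2 * errorWeight σ (k + m + 3) y := by
    rw [abs_div, abs_mul, abs_mul, abs_mul, abs_of_pos hp, abs_of_pos (show 0 < κ ^ 2 by positivity),
      abs_two]
    calc _ ≤ 2 * (p * ((A * (1 + |y|) ^ k) * (B * (1 + |y|) ^ m))) / κ ^ 2 := by gcongr
      _ = 2 * (A * B) / κ ^ 2 * (p * (1 + |y|) ^ (k + m)) := by ring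
      _ ≤ 2 * (A * B) / κ ^ 2 * (Real.exp 3 * errorWeight σ (k + m + 1) y) := by
        exact mul_le_mul_of_nonneg_left (profile_mul_pow_le s₁ s₂ y (k + m)) (by positivity)
      _ = 2 * (A * B) * Real.exp 3 / κ ^ 2 * errorWeight σ (k + m + 1) y := by ring
      _ ≤ _ := by gcongr; exact errorWeight_mono σ (by omega) y
  rw [heq]
  refine (abs_add_le _ _).trans ((add_le_add ((abs_add_le _ _).trans (add_le_add t1 t2)) t3).trans
    (le_of_eq (by ring)))

theorem exists_term_bound {b s₁ s₂ : ℝ} (hb : 0 < b) (hs₁ : 0 < s₁) (hs₂ : 0 < s₂) :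
    ∃ C κ₀ : ℝ, 0 < C ∧ 1 ≤ κ₀ ∧ ∀ κ L y, κ₀ ≤ κ → -(κ / 2) < y →
      |Real.exp (edgePhase b κ s₁ y + edgePhase b κ s₂ y) / (innerMass κ y + outerMass κ L y)| ≤
      C * errorWeight (s₁ + s₂) 1 y := by
  obtain ⟨K, κ₀, hK, hκ₀, hE⟩ := exists_exp_edgePhase_expansion hb hs₁ hs₂
  refine ⟨K * (2 * Real.exp 3) * Real.exp 2, κ₀, by positivity, hκ₀, fun κ L y hκ hy => ?_⟩
  have hκ1 : 1 ≤ κ := hκ₀.trans hκ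
  have hκ0 : 0 < κ := by linarith
  have hE' := (hE κ y hκ).1
  have hVle := inv_mass_le (L := L) hκ0 hy
  have hlam := mills_le y
  have hmass := mass_pos (L := L) hκ0 hy
  rw [abs_of_pos (by positivity), div_eq_mul_one_div]
  -- With m = min(y, 0), the loss −2m from the crude edge bounds is absorbed by half of the Mills
  -- Gaussian: −2m − m² ≤ 2 − m²/2.
  have h2 : Real.exp (-((s₁ + s₂) * y) - 2 * min y 0) * Real.exp (-(min y 0) ^ 2) ≤
      Real.exp 2 * Real.exp (-((min y 0) ^ 2 / 2)) * Real.exp (-((s₁ + s₂) * y)) := by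
    rw [← Real.exp_add, ← Real.exp_add, ← Real.exp_add]
    refine Real.exp_le_exp.2 ?_
    nlinarith [sq_nonneg (min y 0 + 2)]
  calc _ ≤ K * Real.exp (-((s₁ + s₂) * y) - 2 * min y 0) *
        (2 * (Real.exp 3 * (1 + |y|) * Real.exp (-(min y 0) ^ 2))) := by
        gcongr
        exact hVle.trans (by gcongr)
    _ = K * (2 * Real.exp 3) * (1 + |y|) *
        (Real.exp (-((s₁ + s₂) * y) - 2 * min y 0) * Real.exp (-(min y 0) ^ 2)) := by ring
    _ ≤ K * (2 * Real.exp 3) * (1 + |y|) *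
        (Real.exp 2 * Real.exp (-((min y 0) ^ 2 / 2)) * Real.exp (-((s₁ + s₂) * y))) := by gcongr
    _ = _ := by rw [errorWeight]; ring

/-- The expansion is used for |y| ≤ c₀κ. Farther out the term and its approximation are each
exponentially small, and half of their decay rate pays for the factor κ⁻². -/
theorem exists_term_expansion {b s₁ s₂ l : ℝ} (hb : 0 < b) (hs₁ : 0 < s₁) (hs₂ : 0 < s₂)
    (hl : 0 < l) : ∃ C c κ₀ : ℝ, 0 < C ∧ 0 < c ∧ 1 ≤ κ₀ ∧ ∀ κ y, κ₀ ≤ κ → -(κ / 2) < y →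
      |Real.exp (edgePhase b κ s₁ y + edgePhase b κ s₂ y)
          / (innerMass κ y + outerMass κ (κ * l) y)
        - 2 * profile s₁ s₂ y * (1 + termCorrection b s₁ s₂ y / κ)| ≤
      C / κ ^ 2 * Real.exp (-(c * |y|)) := by
  obtain ⟨C₁, κ₁, k, hC₁, hκ₁, h₁⟩ := exists_term_expansion_inner hb hs₁ hs₂ hl
  obtain ⟨C₂, κ₂, hC₂, hκ₂, h₂⟩ := exists_term_bound hb hs₁ hs₂
  obtain ⟨A, m, hA, hψ⟩ := polyGrowth_termCorrection b s₁ s₂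
  have hσ : 0 < s₁ + s₂ := by positivity
  obtain ⟨D₁, hD₁, hw₁⟩ := exists_errorWeight_le hσ k
  obtain ⟨D₂, hD₂, hw₂⟩ := exists_errorWeight_le hσ (m + 1)
  -- The two constants are those of the hypotheses of `exists_term_expansion_inner`: 1/40 from the
  -- majorant of the inner mass, l/4 from the bound on the outer mass.
  set c₀ := min (1 / 40) (l / 4) with hc₀
  have hc₀0 : 0 < c₀ := by positivity
  set σ := s₁ + s₂ with hσd
  set G := 2 / (σ / 4 * c₀) ^ 2 with hG
  refine ⟨C₁ * D₁ + (C₂ + 2 * (1 + A) * Real.exp 3) * D₂ * G, σ / 4, max κ₁ κ₂, by positivity,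
    by positivity, hκ₁.trans (le_max_left _ _), fun κ y hκ hy => ?_⟩
  have hκ1 : 1 ≤ κ := (hκ₁.trans (le_max_left _ _)).trans hκ
  have hκ0 : 0 < κ := by linarith
  have hy0 := abs_nonneg y
  by_cases hin : |y| ≤ c₀ * κ
  · have a1 : c₀ * κ ≤ 1 / 40 * κ := by gcongr; exact min_le_left _ _
    have a2 : c₀ * κ ≤ l / 4 * κ := by gcongr; exact min_le_right _ _
    have := neg_abs_le y
    have := le_abs_self y
    refine (h₁ κ y ((le_max_left _ _).trans hκ) (by linarith) (by linarith) (by linarith)).trans ?_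
    calc C₁ / κ ^ 2 * errorWeight σ k y ≤ C₁ / κ ^ 2 * (D₁ * Real.exp (-(σ / 2 * |y|))) := by
          gcongr; exact hw₁ y
      _ ≤ C₁ / κ ^ 2 * (D₁ * Real.exp (-(σ / 4 * |y|))) := by gcongr; norm_num
      _ = C₁ * D₁ / κ ^ 2 * Real.exp (-(σ / 4 * |y|)) := by ring
      _ ≤ _ := by
        gcongr
        have : 0 < (C₂ + 2 * (1 + A) * Real.exp 3) * D₂ * G := by positivity
        linarith
  · have hout : c₀ * κ ≤ |y| := (not_le.1 hin).le
    have b1 := h₂ κ (κ * l) y ((le_max_right _ _).trans hκ) hy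
    have h1y : 1 ≤ 1 + |y| := by linarith
    have b2 : |2 * profile s₁ s₂ y * (1 + termCorrection b s₁ s₂ y / κ)| ≤
        2 * (1 + A) * Real.exp 3 * errorWeight σ (m + 1) y := by
      have hp := profile_pos s₁ s₂ y
      have h2 : |1 + termCorrection b s₁ s₂ y / κ| ≤ (1 + A) * (1 + |y|) ^ m := by
        have h3 : |termCorrection b s₁ s₂ y / κ| ≤ A * (1 + |y|) ^ m := by
          rw [abs_div, abs_of_pos hκ0]
          exact (div_le_self (abs_nonneg _) hκ1).trans (hψ y)
        have h4 : 1 ≤ (1 + |y|) ^ m := one_le_pow₀ h1y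
        calc _ ≤ |1| + |termCorrection b s₁ s₂ y / κ| := abs_add_le _ _
          _ ≤ _ := by rw [abs_one]; linarith
      rw [abs_mul, abs_of_pos (by positivity : 0 < 2 * profile s₁ s₂ y)]
      calc _ ≤ 2 * profile s₁ s₂ y * ((1 + A) * (1 + |y|) ^ m) := by gcongr
        _ = 2 * (1 + A) * (profile s₁ s₂ y * (1 + |y|) ^ m) := by ring
        _ ≤ 2 * (1 + A) * (Real.exp 3 * errorWeight σ (m + 1) y) := by
          exact mul_le_mul_of_nonneg_left (profile_mul_pow_le s₁ s₂ y m) (by positivity)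
        _ = _ := by ring
    have b3 : Real.exp (-(σ / 2 * |y|)) ≤ G / κ ^ 2 * Real.exp (-(σ / 4 * |y|)) := by
      have h3 : Real.exp (-(σ / 4 * |y|)) ≤ G / κ ^ 2 := by
        set x := σ / 4 * c₀ * κ with hx
        have hx0 : 0 < x := by positivity
        have h4 : Real.exp (-(σ / 4 * |y|)) ≤ Real.exp (-x) := by
          refine Real.exp_le_exp.2 ?_
          rw [hx, mul_assoc]
          have : σ / 4 * (c₀ * κ) ≤ σ / 4 * |y| := by gcongr
          linarith
        have h5 : Real.exp (-x) ≤ 2 / x ^ 2 := by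
          rw [Real.exp_neg, ← inv_div]
          gcongr
          have := Real.quadratic_le_exp_of_nonneg hx0.le
          linarith
        refine (h4.trans h5).trans (le_of_eq ?_)
        rw [hx, hG]; field_simp
      calc Real.exp (-(σ / 2 * |y|)) = Real.exp (-(σ / 4 * |y|)) * Real.exp (-(σ / 4 * |y|)) := by
            rw [← Real.exp_add]; congr 1; ring
        _ ≤ _ := by gcongr
    have b4 : errorWeight σ 1 y ≤ errorWeight σ (m + 1) y := errorWeight_mono σ (by omega) y
    calc _ ≤ C₂ * errorWeight σ 1 y + 2 * (1 + A) * Real.exp 3 * errorWeight σ (m + 1) y :=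
          (abs_sub _ _).trans (add_le_add b1 b2)
      _ ≤ C₂ * errorWeight σ (m + 1) y + 2 * (1 + A) * Real.exp 3 * errorWeight σ (m + 1) y := by
          gcongr
      _ = (C₂ + 2 * (1 + A) * Real.exp 3) * errorWeight σ (m + 1) y := by ring
      _ ≤ (C₂ + 2 * (1 + A) * Real.exp 3) *
          (D₂ * (G / κ ^ 2 * Real.exp (-(σ / 4 * |y|)))) := by
        gcongr
        exact (hw₂ y).trans (by gcongr)
      _ = (C₂ + 2 * (1 + A) * Real.exp 3) * D₂ * G / κ ^ 2 * Real.exp (-(σ / 4 * |y|)) := by ring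
      _ ≤ _ := by
        gcongr
        have : 0 < C₁ * D₁ := by positivity
        linarith

/-! ### Midpoint Riemann sums over the whole line. -/

theorem exp_neg_abs_le_of_near {c t y : ℝ} (hc : 0 < c) (h : |t - y| ≤ 1 / 2) :
    Real.exp (-(c * |t|)) ≤ Real.exp (c / 2) * Real.exp (-(c * |y|)) := by
  rw [← Real.exp_add]
  refine Real.exp_le_exp.2 ?_
  have h1 : |y| - |t| ≤ |t - y| := by rw [abs_sub_comm]; exact abs_sub_abs_le_abs_sub y t
  nlinarith

theorem midpoint_error_of_deriv_le {g g' : ℝ → ℝ} (hg : ∀ x, HasDerivAt g (g' x) x) {h y M : ℝ}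
    (hh : 0 < h) (hM : ∀ t, |t - y| ≤ h / 2 → |g' t| ≤ M) :
    |h * g y - ∫ t in (y - h / 2)..(y + h / 2), g t| ≤ M * h ^ 2 / 2 := by
  have hcont : Continuous g := continuous_iff_continuousAt.2 fun x => (hg x).continuousAt
  have hM0 : 0 ≤ M := (abs_nonneg _).trans (hM y (by simp; positivity))
  have heq : h * g y - ∫ t in (y - h / 2)..(y + h / 2), g t
      = ∫ t in (y - h / 2)..(y + h / 2), (g y - g t) := by
    rw [intervalIntegral.integral_sub (by simp) (hcont.intervalIntegrable _ _)]
    simp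
  have hbound : ∀ t ∈ uIoc (y - h / 2) (y + h / 2), ‖g y - g t‖ ≤ M * (h / 2) := by
    intro t ht
    rw [uIoc_of_le (by linarith)] at ht
    have hty : |t - y| ≤ h / 2 := by rw [abs_le]; constructor <;> linarith [ht.1, ht.2]
    have := (convex_Icc (y - h / 2) (y + h / 2)).norm_image_sub_le_of_norm_hasDerivWithin_le
      (f := g) (f' := g') (C := M) (x := t) (y := y) (fun x _ => (hg x).hasDerivWithinAt)
      (fun x hx => hM x (by rw [abs_le]; constructor <;> linarith [hx.1, hx.2]))
      ⟨ht.1.le, ht.2⟩ ⟨by linarith, by linarith⟩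
    refine this.trans ?_
    gcongr
    rwa [Real.norm_eq_abs, abs_sub_comm]
  rw [heq, ← Real.norm_eq_abs]
  refine (intervalIntegral.norm_integral_le_of_norm_le_const hbound).trans (le_of_eq ?_)
  rw [show y + h / 2 - (y - h / 2) = h by ring, abs_of_pos hh]
  ring

/-- The local midpoint rule has error of order `m + 1`, with exponentially decaying constants. -/
def MidpointOrder (f : ℝ → ℝ) (m : ℕ) : Prop :=
  ∃ M c : ℝ, 0 < M ∧ 0 < c ∧ ∀ h y : ℝ, 0 < h → h ≤ 1 →
    |h * f y - ∫ t in (y - h / 2)..(y + h / 2), f t| ≤ M * h ^ (m + 1) * Real.exp (-(c * |y|))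

theorem midpointOrder_one {f f' : ℝ → ℝ} (hf : ∀ x, HasDerivAt f (f' x) x) (hf' : ExpDecay f') :
    MidpointOrder f 1 := by
  obtain ⟨C, c, hC, hc, hb⟩ := hf'
  refine ⟨C * Real.exp (c / 2) / 2, c, by positivity, hc, fun h y hh hh1 => ?_⟩
  refine (midpoint_error_of_deriv_le hf (M := C * (Real.exp (c / 2) * Real.exp (-(c * |y|)))) hh
    fun t ht => (hb t).trans ?_).trans (le_of_eq (by ring))
  gcongr
  exact exp_neg_abs_le_of_near hc (by linarith)

/-- Subtracting the linear function f'(y)(t − y) changes neither the value at the midpoint nor the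
integral over the symmetric cell. The new derivative is at most Mh/2, and the first-order bound
gains a power of h. -/
theorem midpointOrder_two {f f' f'' : ℝ → ℝ} (hf : ∀ x, HasDerivAt f (f' x) x)
    (hf' : ∀ x, HasDerivAt f' (f'' x) x) (hf'' : ExpDecay f'') : MidpointOrder f 2 := by
  obtain ⟨C, c, hC, hc, hb⟩ := hf''
  refine ⟨C * Real.exp (c / 2) / 4, c, by positivity, hc, fun h y hh hh1 => ?_⟩
  set M := C * (Real.exp (c / 2) * Real.exp (-(c * |y|))) with hM
  have hM0 : 0 < M := by positivity
  have hM' : ∀ t, |t - y| ≤ h / 2 → |f'' t| ≤ M := fun t ht => (hb t).trans (by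
    rw [hM]
    gcongr
    exact exp_neg_abs_le_of_near hc (by linarith))
  set g : ℝ → ℝ := fun t => f t - f' y * (t - y) with hg
  have hgd : ∀ t, HasDerivAt g (f' t - f' y) t := fun t => by
    have := (hf t).sub (((hasDerivAt_id t).sub_const y).const_mul (f' y))
    exact this.congr_deriv (by simp)
  have hbd : ∀ t, |t - y| ≤ h / 2 → |f' t - f' y| ≤ M * (h / 2) := by
    intro t ht
    have ht' := abs_le.1 ht
    have := (convex_Icc (y - h / 2) (y + h / 2)).norm_image_sub_le_of_norm_hasDerivWithin_le
      (f := f') (f' := f'') (C := M) (x := y) (y := t) (fun x _ => (hf' x).hasDerivWithinAt)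
      (fun x hx => hM' x (by rw [abs_le]; constructor <;> linarith [hx.1, hx.2]))
      ⟨by linarith, by linarith⟩ ⟨by linarith, by linarith⟩
    refine this.trans ?_
    gcongr
    rwa [Real.norm_eq_abs]
  have key := midpoint_error_of_deriv_le hgd hh hbd
  have hcont : Continuous f := continuous_iff_continuousAt.2 fun x => (hf x).continuousAt
  have hgint : ∫ t in (y - h / 2)..(y + h / 2), g t = ∫ t in (y - h / 2)..(y + h / 2), f t := by
    rw [hg, intervalIntegral.integral_sub (hcont.intervalIntegrable _ _)
      (Continuous.intervalIntegrable (by fun_prop) _ _), intervalIntegral.integral_const_mul,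
      intervalIntegral.integral_sub (Continuous.intervalIntegrable (by fun_prop) _ _) (by simp),
      integral_id]
    simp
    right
    ring
  have hgy : g y = f y := by simp [hg]
  rw [hgint, hgy] at key
  refine key.trans (le_of_eq ?_)
  rw [hM]; ring

/-- Each summand is compared with the integral over its own cell; the constant does not depend on
the offset or the length of the grid. -/
theorem exists_sum_exp_neg_abs_le {c : ℝ} (hc : 0 < c) : ∃ S : ℝ, 0 < S ∧
    ∀ (h y₀ : ℝ) (n : ℕ), 0 < h → h ≤ 1 →
      h * ∑ k ∈ Finset.range n, Real.exp (-(c * |y₀ + k * h|)) ≤ S := by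
  have hint := integrable_exp_neg_abs hc
  have hI : 0 ≤ ∫ t : ℝ, Real.exp (-(c * |t|)) := integral_nonneg fun t => (Real.exp_pos _).le
  refine ⟨Real.exp (c / 2) * (∫ t : ℝ, Real.exp (-(c * |t|))) + 1, by positivity,
    fun h y₀ n hh hh1 => ?_⟩
  set a : ℕ → ℝ := fun k => y₀ - h / 2 + k * h with ha
  have hadj := intervalIntegral.sum_integral_adjacent_intervals (μ := volume) (a := a) (n := n)
    (f := fun t => Real.exp (-(c * |t|))) fun k _ => hint.intervalIntegrable
  have hterm : ∀ k ∈ Finset.range n, h * Real.exp (-(c * |y₀ + k * h|)) ≤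
      Real.exp (c / 2) * ∫ t in a k..a (k + 1), Real.exp (-(c * |t|)) := by
    intro k _
    have hle : a k ≤ a (k + 1) := by simp only [ha]; push_cast; linarith
    have hconst : h * Real.exp (-(c * |y₀ + k * h|))
        = ∫ _ in a k..a (k + 1), Real.exp (-(c * |y₀ + k * h|)) := by
      rw [intervalIntegral.integral_const, smul_eq_mul]
      congr 1
      simp only [ha]; push_cast; ring
    rw [hconst, ← intervalIntegral.integral_const_mul]
    refine intervalIntegral.integral_mono_on hle (by simp)
      (hint.const_mul _).intervalIntegrable fun t ht => ?_
    refine exp_neg_abs_le_of_near hc ?_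
    simp only [ha] at ht
    push_cast at ht
    rw [abs_le]
    constructor <;> linarith [ht.1, ht.2]
  have hle0 : a 0 ≤ a n := by
    simp only [ha]
    have : 0 ≤ (n : ℝ) * h := by positivity
    simpa using this
  rw [Finset.mul_sum]
  refine (Finset.sum_le_sum hterm).trans ?_
  rw [← Finset.mul_sum, hadj, intervalIntegral.integral_of_le hle0]
  have : ∫ t in Ioc (a 0) (a n), Real.exp (-(c * |t|)) ≤ ∫ t : ℝ, Real.exp (-(c * |t|)) :=
    setIntegral_le_integral hint (Eventually.of_forall fun t => (Real.exp_pos _).le)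
  have h2 := mul_le_mul_of_nonneg_left this (Real.exp_pos (c / 2)).le
  linarith

theorem integral_exp_neg_abs_Ioi {c B : ℝ} (hc : 0 < c) (hB : 0 ≤ B) :
    ∫ t in Ioi B, Real.exp (-(c * |t|)) = Real.exp (-(c * B)) / c := by
  have h1 : ∫ t in Ioi B, Real.exp (-(c * |t|)) = ∫ t in Ioi B, Real.exp (-c * t) := by
    refine setIntegral_congr_fun measurableSet_Ioi fun t ht => ?_
    have : 0 < t := lt_of_le_of_lt hB ht
    simp only [abs_of_pos this, neg_mul]
  rw [h1, integral_exp_mul_Ioi (by linarith), neg_div_neg_eq, neg_mul]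

theorem integral_exp_neg_abs_Iic {c A : ℝ} (hc : 0 < c) (hA : A ≤ 0) :
    ∫ t in Iic A, Real.exp (-(c * |t|)) = Real.exp (c * A) / c := by
  have h := integral_comp_neg_Iic A fun t => Real.exp (-(c * |t|))
  simp only [abs_neg] at h
  rw [h, integral_exp_neg_abs_Ioi hc (by linarith)]
  congr 2; ring

theorem exp_neg_div_le (m : ℕ) {a h : ℝ} (ha : 0 < a) (hh : 0 < h) :
    Real.exp (-(a / h)) ≤ m.factorial / a ^ m * h ^ m := by
  have h1 := Real.pow_div_factorial_le_exp (x := a / h) (by positivity) m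
  rw [Real.exp_neg]
  refine (inv_anti₀ (by positivity) h1).trans (le_of_eq ?_)
  rw [inv_div, div_pow]
  field_simp

/-- The cells tile an interval containing [−c₁/h, c₁/h], so the missing tails are O(e^{−dc₁/h}),
smaller than any power of h. The local errors, of order h^{m+1}, sum to h^m thanks to their
exponentially decaying constants. -/
theorem exists_riemann_error {f : ℝ → ℝ} (hcont : Continuous f) (hf : ExpDecay f) {m : ℕ}
    (hm : MidpointOrder f m) {c₁ : ℝ} (hc₁ : 0 < c₁) : ∃ C : ℝ, 0 < C ∧
    ∀ (h y₀ : ℝ) (n : ℕ), 0 < h → h ≤ 1 → y₀ - h / 2 ≤ -(c₁ / h) → c₁ / h ≤ y₀ - h / 2 + n * h →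
      |h * ∑ k ∈ Finset.range n, f (y₀ + k * h) - ∫ t, f t| ≤ C * h ^ m := by
  have hint := hf.integrable hcont
  obtain ⟨D, d, hD, hd, hfb⟩ := hf
  obtain ⟨M, c, hM, hc, hmid⟩ := hm
  obtain ⟨S, hS, hsum⟩ := exists_sum_exp_neg_abs_le hc
  set G := (m.factorial : ℝ) / (d * c₁) ^ m with hG
  have hG0 : 0 < G := by positivity
  refine ⟨M * S + 2 * (D / d) * G, by positivity, fun h y₀ n hh hh1 hA hB => ?_⟩
  set a : ℕ → ℝ := fun k => y₀ - h / 2 + k * h with ha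
  have ha0 : a 0 = y₀ - h / 2 := by simp [ha]
  have hadj := intervalIntegral.sum_integral_adjacent_intervals (μ := volume) (a := a) (n := n)
    (f := f) fun k _ => hint.intervalIntegrable
  have h1 : |h * ∑ k ∈ Finset.range n, f (y₀ + k * h) - ∫ t in a 0..a n, f t| ≤ M * S * h ^ m := by
    rw [← hadj, Finset.mul_sum, ← Finset.sum_sub_distrib]
    refine (Finset.abs_sum_le_sum_abs _ _).trans ?_
    calc _ ≤ ∑ k ∈ Finset.range n, M * h ^ (m + 1) * Real.exp (-(c * |y₀ + k * h|)) := by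
          refine Finset.sum_le_sum fun k _ => ?_
          have := hmid h (y₀ + k * h) hh hh1
          have e1 : a k = y₀ + k * h - h / 2 := by simp only [ha]; ring
          have e2 : a (k + 1) = y₀ + k * h + h / 2 := by simp only [ha]; push_cast; ring
          rwa [e1, e2]
      _ = M * h ^ m * (h * ∑ k ∈ Finset.range n, Real.exp (-(c * |y₀ + k * h|))) := by
          rw [← Finset.mul_sum]; ring
      _ ≤ M * h ^ m * S := by gcongr; exact hsum h y₀ n hh hh1
      _ = _ := by ring
  have hcpos : 0 < c₁ / h := by positivity
  have hsplit : (∫ t, f t) - ∫ t in a 0..a n, f t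
      = (∫ t in Iic (a 0), f t) + ∫ t in Ioi (a n), f t := by
    have e1 := intervalIntegral.integral_Iic_sub_Iic (a := a 0) (b := a n) (hint.integrableOn)
      (hint.integrableOn)
    have e2 := integral_add_compl (measurableSet_Iic (a := a n)) hint
    rw [compl_Iic] at e2
    linarith
  have hE := integrable_exp_neg_abs hd
  have htail : D / d * Real.exp (-(d * (c₁ / h))) ≤ D / d * G * h ^ m := by
    have := exp_neg_div_le m (a := d * c₁) (by positivity) hh
    rw [mul_div_assoc] at this
    rw [mul_assoc]
    gcongr
  have h2 : |∫ t in Iic (a 0), f t| ≤ D / d * G * h ^ m := by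
    refine le_trans ?_ htail
    rw [← Real.norm_eq_abs]
    refine (norm_integral_le_of_norm_le (hE.const_mul D).integrableOn
      (Eventually.of_forall hfb)).trans ?_
    rw [integral_const_mul, integral_exp_neg_abs_Iic hd (by rw [ha0]; linarith), mul_div_assoc',
      div_mul_eq_mul_div]
    gcongr
    rw [ha0]
    nlinarith
  have h3 : |∫ t in Ioi (a n), f t| ≤ D / d * G * h ^ m := by
    refine le_trans ?_ htail
    rw [← Real.norm_eq_abs]
    refine (norm_integral_le_of_norm_le (hE.const_mul D).integrableOn
      (Eventually.of_forall hfb)).trans ?_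
    rw [integral_const_mul, integral_exp_neg_abs_Ioi hd (by simp only [ha]; linarith),
      mul_div_assoc', div_mul_eq_mul_div]
    gcongr
  have heq : h * ∑ k ∈ Finset.range n, f (y₀ + k * h) - ∫ t, f t
      = (h * ∑ k ∈ Finset.range n, f (y₀ + k * h) - ∫ t in a 0..a n, f t)
        - (∫ t in Iic (a 0), f t) - ∫ t in Ioi (a n), f t := by
    linear_combination -hsplit
  rw [heq]
  refine (abs_sub _ _).trans ((add_le_add ((abs_sub _ _).trans (add_le_add h1 h2)) h3).trans
    (le_of_eq (by ring)))

/-! ### Regularity of the limiting integrands, the total derivative in C₂, and the summation. -/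

/-- The logarithmic derivative of `profile`. -/
def profileSlope (s₁ s₂ y : ℝ) : ℝ := 2 * mills y - 2 * y - (s₁ + s₂)

theorem hasDerivAt_profile (s₁ s₂ y : ℝ) :
    HasDerivAt (profile s₁ s₂) (profile s₁ s₂ y * profileSlope s₁ s₂ y) y := by
  have heq : profile s₁ s₂ =
      fun y => mills y * Real.exp (-((s₁ + s₂) * y) - (s₁ ^ 2 + s₂ ^ 2) / 2) :=
    funext (profile_eq s₁ s₂)
  rw [heq]
  have h := (hasDerivAt_mills y).mul
    ((((hasDerivAt_id y).const_mul (s₁ + s₂)).neg.sub_const ((s₁ ^ 2 + s₂ ^ 2) / 2)).exp)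
  refine h.congr_deriv ?_
  simp only [profileSlope, id, Pi.neg_apply]
  ring

theorem hasDerivAt_profileSlope (s₁ s₂ y : ℝ) : HasDerivAt (profileSlope s₁ s₂)
    (2 * (2 * mills y ^ 2 - 2 * y * mills y) - 2) y := by
  have h := (((hasDerivAt_mills y).const_mul 2).sub ((hasDerivAt_id y).const_mul 2)).sub_const
    (s₁ + s₂)
  exact h.congr_deriv (by simp)

/-- The derivative of `termCorrection`. -/
def termCorrectionDeriv (b s₁ s₂ y : ℝ) : ℝ :=
  -((s₁ ^ 2 + s₂ ^ 2) / (2 * b)) - 2 / 3 * (2 * y * mills y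
    + (1 + y ^ 2) * (2 * mills y ^ 2 - 2 * y * mills y)) + 1 + 2 * y ^ 2

theorem hasDerivAt_edgeCorrection (b s y : ℝ) :
    HasDerivAt (edgeCorrection b s) (-(s ^ 2 / (2 * b))) y := by
  have h := (((((hasDerivAt_id y).mul_const (s ^ 2)).div_const (2 * b)).const_sub (s / b))).add_const
    ((1 / 3 - 1 / (2 * b)) * s ^ 3)
  exact h.congr_deriv (by simp)

theorem hasDerivAt_termCorrection (b s₁ s₂ y : ℝ) :
    HasDerivAt (termCorrection b s₁ s₂) (termCorrectionDeriv b s₁ s₂ y) y := by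
  have hm : HasDerivAt massCorrection (-(2 / 3) * (2 * y * mills y
      + (1 + y ^ 2) * (2 * mills y ^ 2 - 2 * y * mills y)) + 1 + 2 * y ^ 2) y := by
    have h := (((((hasDerivAt_pow 2 y).const_add 1).const_mul (-(2 / 3))).mul
      (hasDerivAt_mills y)).add (hasDerivAt_id y)).add ((hasDerivAt_pow 3 y).const_mul (2 / 3))
    refine h.congr_deriv ?_
    norm_num
    ring
  have h := ((hasDerivAt_edgeCorrection b s₁ y).add (hasDerivAt_edgeCorrection b s₂ y)).add hm
  refine h.congr_deriv ?_
  rw [termCorrectionDeriv]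
  ring

theorem polyGrowth_profileSlope (s₁ s₂ : ℝ) : PolyGrowth (profileSlope s₁ s₂) :=
  (((PolyGrowth.const 2).mul polyGrowth_mills).sub ((PolyGrowth.const 2).mul PolyGrowth.id)).sub
    (PolyGrowth.const (s₁ + s₂))

theorem polyGrowth_millsDeriv : PolyGrowth fun y => 2 * mills y ^ 2 - 2 * y * mills y :=
  ((PolyGrowth.const 2).mul (polyGrowth_mills.pow 2)).sub
    (((PolyGrowth.const 2).mul PolyGrowth.id).mul polyGrowth_mills)

theorem polyGrowth_termCorrectionDeriv (b s₁ s₂ : ℝ) :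
    PolyGrowth (termCorrectionDeriv b s₁ s₂) := by
  have h1 : PolyGrowth fun y => 2 * y * mills y :=
    ((PolyGrowth.const 2).mul PolyGrowth.id).mul polyGrowth_mills
  have h2 : PolyGrowth fun y => (1 + y ^ 2) * (2 * mills y ^ 2 - 2 * y * mills y) :=
    ((PolyGrowth.const 1).add (PolyGrowth.id.pow 2)).mul polyGrowth_millsDeriv
  exact (((PolyGrowth.const _).sub ((PolyGrowth.const (2 / 3)).mul (h1.add h2))).add
    (PolyGrowth.const 1)).add ((PolyGrowth.const 2).mul (PolyGrowth.id.pow 2))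

theorem continuous_of_hasDerivAt {f f' : ℝ → ℝ} (h : ∀ y, HasDerivAt f (f' y) y) : Continuous f :=
  continuous_iff_continuousAt.2 fun y => (h y).continuousAt

section
variable {b s₁ s₂ : ℝ}

/-- Second order is required because this Riemann sum is later multiplied by (bκ)² = h⁻². The sum
with `termCorrection` is multiplied only by b²κ, so first order suffices there. -/
theorem midpointOrder_profile (hσ : 0 < s₁ + s₂) : MidpointOrder (profile s₁ s₂) 2 := by
  refine midpointOrder_two (hasDerivAt_profile s₁ s₂)
    (fun y => (hasDerivAt_profile s₁ s₂ y).mul (hasDerivAt_profileSlope s₁ s₂ y)) ?_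
  have h := expDecay_profile_mul hσ (((polyGrowth_profileSlope s₁ s₂).pow 2).add
    (((PolyGrowth.const 2).mul polyGrowth_millsDeriv).sub (PolyGrowth.const 2)))
  refine (congrArg ExpDecay (funext fun y => ?_)).mpr h
  ring

theorem hasDerivAt_profile_mul_termCorrection (b s₁ s₂ y : ℝ) :
    HasDerivAt (fun y => profile s₁ s₂ y * termCorrection b s₁ s₂ y)
      (profile s₁ s₂ y * (profileSlope s₁ s₂ y * termCorrection b s₁ s₂ y
        + termCorrectionDeriv b s₁ s₂ y)) y := by
  refine ((hasDerivAt_profile s₁ s₂ y).mul (hasDerivAt_termCorrection b s₁ s₂ y)).congr_deriv ?_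
  ring

theorem midpointOrder_profile_mul_termCorrection (b : ℝ) (hσ : 0 < s₁ + s₂) :
    MidpointOrder (fun y => profile s₁ s₂ y * termCorrection b s₁ s₂ y) 1 :=
  midpointOrder_one (hasDerivAt_profile_mul_termCorrection b s₁ s₂)
    (expDecay_profile_mul hσ (((polyGrowth_profileSlope s₁ s₂).mul
      (polyGrowth_termCorrection b s₁ s₂)).add (polyGrowth_termCorrectionDeriv b s₁ s₂)))

theorem integrable_profile (hσ : 0 < s₁ + s₂) : Integrable (profile s₁ s₂) :=
  (expDecay_profile hσ).integrable (continuous_of_hasDerivAt (hasDerivAt_profile s₁ s₂))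

theorem integrable_profile_mul_termCorrection (b : ℝ) (hσ : 0 < s₁ + s₂) :
    Integrable fun y => profile s₁ s₂ y * termCorrection b s₁ s₂ y :=
  (expDecay_profile_mul hσ (polyGrowth_termCorrection b s₁ s₂)).integrable
    (continuous_of_hasDerivAt (hasDerivAt_profile_mul_termCorrection b s₁ s₂))

/-- After multiplication by `profile`, the added parenthesis is the derivative of 2y²·`profile`,
which integrates to zero. The stated bracket and the one found by direct expansion therefore give
the same coefficient. -/
theorem correction_eq (hb : 0 < b) (y : ℝ) : correction b s₁ s₂ y =
    termCorrection b s₁ s₂ y + (2 * y ^ 2 * profileSlope s₁ s₂ y + 4 * y) := by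
  have hE := erfc_pos y
  have h1 : (10 * y ^ 2 - 2) * Real.exp (-y ^ 2) / (3 * √π * erfc y)
      = (10 * y ^ 2 - 2) / 3 * mills y := by
    rw [mills]; field_simp
  rw [correction, h1, termCorrection, edgeCorrection, edgeCorrection, massCorrection, profileSlope]
  field_simp
  ring

theorem hasDerivAt_sq_mul_profile (s₁ s₂ y : ℝ) : HasDerivAt (fun y => 2 * y ^ 2 * profile s₁ s₂ y)
    (profile s₁ s₂ y * (2 * y ^ 2 * profileSlope s₁ s₂ y + 4 * y)) y := by
  refine (((hasDerivAt_pow 2 y).const_mul 2).mul (hasDerivAt_profile s₁ s₂ y)).congr_deriv ?_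
  norm_num
  ring

theorem integrable_deriv_sq_mul_profile (hσ : 0 < s₁ + s₂) : Integrable fun y =>
    profile s₁ s₂ y * (2 * y ^ 2 * profileSlope s₁ s₂ y + 4 * y) := by
  have hsq : PolyGrowth fun y => 2 * y ^ 2 := (PolyGrowth.const 2).mul (PolyGrowth.id.pow 2)
  refine (expDecay_profile_mul hσ ((hsq.mul (polyGrowth_profileSlope s₁ s₂)).add
    ((PolyGrowth.const 4).mul PolyGrowth.id))).integrable ?_
  have h1 := continuous_of_hasDerivAt (hasDerivAt_profile s₁ s₂)
  have h2 := continuous_of_hasDerivAt (hasDerivAt_profileSlope s₁ s₂)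
  fun_prop

theorem integral_deriv_sq_mul_profile (hσ : 0 < s₁ + s₂) :
    ∫ y, profile s₁ s₂ y * (2 * y ^ 2 * profileSlope s₁ s₂ y + 4 * y) = 0 := by
  refine integral_eq_zero_of_hasDerivAt_of_integrable (hasDerivAt_sq_mul_profile s₁ s₂)
    (integrable_deriv_sq_mul_profile hσ) ?_
  have hsq : PolyGrowth fun y => 2 * y ^ 2 := (PolyGrowth.const 2).mul (PolyGrowth.id.pow 2)
  have h := (expDecay_profile_mul hσ hsq).integrable (by
    have h1 := continuous_of_hasDerivAt (hasDerivAt_profile s₁ s₂)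
    fun_prop)
  simpa only [mul_comm] using h

theorem integrable_profile_mul_correction (hb : 0 < b) (hσ : 0 < s₁ + s₂) :
    Integrable fun y => profile s₁ s₂ y * correction b s₁ s₂ y := by
  simp only [correction_eq hb, mul_add (profile _ _ _) (termCorrection _ _ _ _)]
  exact (integrable_profile_mul_termCorrection b hσ).add (integrable_deriv_sq_mul_profile hσ)

theorem integral_profile_mul_correction (hb : 0 < b) (hσ : 0 < s₁ + s₂) :
    ∫ y, profile s₁ s₂ y * correction b s₁ s₂ y =
      ∫ y, profile s₁ s₂ y * termCorrection b s₁ s₂ y := by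
  simp only [correction_eq hb, mul_add (profile _ _ _) (termCorrection _ _ _ _)]
  rw [integral_add (integrable_profile_mul_termCorrection b hσ)
    (integrable_deriv_sq_mul_profile hσ), integral_deriv_sq_mul_profile hσ, add_zero]

/-- With h = 1/(bκ), the prefactor bκ/2 turns twice the sum of `profile` into (bκ)² times a Riemann
sum. All three errors are O(1): κ · κ⁻² · h⁻¹ from the terms, κ²h² from the leading Riemann sum and
κh from the correction. -/
theorem exists_sum_asymptotics {l c₁ : ℝ} (hb : 0 < b) (hs₁ : 0 < s₁) (hs₂ : 0 < s₂) (hl : 0 < l)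
    (hc₁ : 0 < c₁) : ∃ C κ₀ : ℝ, 1 ≤ κ₀ ∧ ∀ (κ y₀ : ℝ) (n : ℕ), κ₀ ≤ κ → -(κ / 2) < y₀ →
      y₀ - 1 / (b * κ) / 2 ≤ -(c₁ * κ) → c₁ * κ ≤ y₀ - 1 / (b * κ) / 2 + n * (1 / (b * κ)) →
      |b * κ / 2 * ∑ k ∈ Finset.range n,
          (Real.exp (edgePhase b κ s₁ (y₀ + k * (1 / (b * κ)))
              + edgePhase b κ s₂ (y₀ + k * (1 / (b * κ))))
            / (innerMass κ (y₀ + k * (1 / (b * κ))) + outerMass κ (κ * l) (y₀ + k * (1 / (b * κ)))))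
        - (b ^ 2 * κ ^ 2 * (∫ y, profile s₁ s₂ y)
          + b ^ 2 * κ * ∫ y, profile s₁ s₂ y * termCorrection b s₁ s₂ y)| ≤ C := by
  have hσ : 0 < s₁ + s₂ := by positivity
  obtain ⟨C, c, κ₀, hC, hc, hκ₀, hterm⟩ := exists_term_expansion hb hs₁ hs₂ hl
  obtain ⟨S, hS, hsum⟩ := exists_sum_exp_neg_abs_le hc
  obtain ⟨D, hD, hp⟩ := exists_riemann_error (continuous_of_hasDerivAt (hasDerivAt_profile s₁ s₂))
    (expDecay_profile hσ) (midpointOrder_profile hσ) (c₁ := c₁ / b) (by positivity)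
  obtain ⟨E, hE, hq⟩ := exists_riemann_error
    (continuous_of_hasDerivAt (hasDerivAt_profile_mul_termCorrection b s₁ s₂))
    (expDecay_profile_mul hσ (polyGrowth_termCorrection b s₁ s₂))
    (midpointOrder_profile_mul_termCorrection b hσ) (c₁ := c₁ / b) (by positivity)
  refine ⟨b ^ 2 * C * S / 2 + D + b * E, max κ₀ (1 / b), hκ₀.trans (le_max_left _ _),
    fun κ y₀ n hκ hy₀ hA hB => ?_⟩
  have hκ1 : κ₀ ≤ κ := (le_max_left _ _).trans hκ
  have hκ0 : 0 < κ := by linarith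
  have hbκ : 1 ≤ b * κ := by
    have := (le_max_right κ₀ (1 / b)).trans hκ
    rw [div_le_iff₀ hb] at this
    linarith
  have hbκ0 : 0 < b * κ := by positivity
  set h := 1 / (b * κ) with hh
  have hh0 : 0 < h := by positivity
  have hh1 : h ≤ 1 := by rw [hh, div_le_one hbκ0]; exact hbκ
  have hch : c₁ / b / h = c₁ * κ := by rw [hh]; field_simp
  have hp' := hp h y₀ n hh0 hh1 (by rwa [hch]) (by rwa [hch])
  have hq' := hq h y₀ n hh0 hh1 (by rwa [hch]) (by rwa [hch])
  have hs' := hsum h y₀ n hh0 hh1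
  set Φ : ℕ → ℝ := fun k => Real.exp (edgePhase b κ s₁ (y₀ + k * h) + edgePhase b κ s₂ (y₀ + k * h))
    / (innerMass κ (y₀ + k * h) + outerMass κ (κ * l) (y₀ + k * h)) with hΦ
  set P := ∫ y, profile s₁ s₂ y with hP
  set Q := ∫ y, profile s₁ s₂ y * termCorrection b s₁ s₂ y with hQ
  set Sp := ∑ k ∈ Finset.range n, profile s₁ s₂ (y₀ + k * h) with hSp
  set Sq := ∑ k ∈ Finset.range n, profile s₁ s₂ (y₀ + k * h) * termCorrection b s₁ s₂ (y₀ + k * h)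
    with hSq
  have hdiff : |∑ k ∈ Finset.range n, Φ k - (2 * Sp + 2 * Sq / κ)| ≤ C / κ ^ 2 * (S / h) := by
    have heq : ∑ k ∈ Finset.range n, Φ k - (2 * Sp + 2 * Sq / κ) = ∑ k ∈ Finset.range n,
        (Φ k - 2 * profile s₁ s₂ (y₀ + k * h) * (1 + termCorrection b s₁ s₂ (y₀ + k * h) / κ)) := by
      rw [Finset.sum_sub_distrib, hSp, hSq, mul_div_right_comm, Finset.mul_sum, Finset.mul_sum,
        ← Finset.sum_add_distrib]
      congr 1
      refine Finset.sum_congr rfl fun k _ => ?_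
      ring
    rw [heq]
    refine (Finset.abs_sum_le_sum_abs _ _).trans ?_
    calc _ ≤ ∑ k ∈ Finset.range n, C / κ ^ 2 * Real.exp (-(c * |y₀ + k * h|)) := by
          refine Finset.sum_le_sum fun k _ => hterm κ _ hκ1 ?_
          have : 0 ≤ (k : ℝ) * h := by positivity
          linarith
      _ = C / κ ^ 2 * ∑ k ∈ Finset.range n, Real.exp (-(c * |y₀ + k * h|)) := by
          rw [Finset.mul_sum]
      _ ≤ _ := by
          gcongr
          rw [le_div_iff₀ hh0]
          linarith
  have heq : b * κ / 2 * ∑ k ∈ Finset.range n, Φ k - (b ^ 2 * κ ^ 2 * P + b ^ 2 * κ * Q)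
      = b * κ / 2 * (∑ k ∈ Finset.range n, Φ k - (2 * Sp + 2 * Sq / κ))
        + (b * κ) ^ 2 * (h * Sp - P) + b ^ 2 * κ * (h * Sq - Q) := by
    rw [hh]; field_simp; ring
  have t1 : |b * κ / 2 * (∑ k ∈ Finset.range n, Φ k - (2 * Sp + 2 * Sq / κ))| ≤
      b ^ 2 * C * S / 2 := by
    rw [abs_mul, abs_of_pos (by positivity : 0 < b * κ / 2)]
    refine (mul_le_mul_of_nonneg_left hdiff (by positivity)).trans (le_of_eq ?_)
    rw [hh]; field_simp
  have t2 : |(b * κ) ^ 2 * (h * Sp - P)| ≤ D := by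
    rw [abs_mul, abs_of_pos (by positivity : 0 < (b * κ) ^ 2)]
    refine (mul_le_mul_of_nonneg_left hp' (by positivity)).trans (le_of_eq ?_)
    rw [hh]; field_simp
  have t3 : |b ^ 2 * κ * (h * Sq - Q)| ≤ b * E := by
    rw [abs_mul, abs_of_pos (by positivity : 0 < b ^ 2 * κ)]
    refine (mul_le_mul_of_nonneg_left hq' (by positivity)).trans (le_of_eq ?_)
    rw [hh]; field_simp
  rw [heq]
  exact (abs_add_le _ _).trans (add_le_add ((abs_add_le _ _).trans (add_le_add t1 t2)) t3)

end

/-! ### Exact reduction of the norms and of the kernel to rescaled form. -/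

theorem innerMass_eq_integral_Iic (κ y : ℝ) : innerMass κ y =
    ∫ u in Iic (0 : ℝ), Real.exp (2 * y * u - κ ^ 2 / 2 * expRem (2 * u / κ)) := by
  have h := integral_comp_neg_Ioi (0 : ℝ)
    fun u : ℝ => Real.exp (2 * y * u - κ ^ 2 / 2 * expRem (2 * u / κ))
  rw [neg_zero] at h
  rw [← h, innerMass]
  refine setIntegral_congr_fun measurableSet_Ioi fun u _ => ?_
  simp only [innerPhase]
  congr 2
  · ring
  · congr 2; ring

theorem integrableOn_outerMass {κ L : ℝ} (y : ℝ) (hκ : 0 < κ) (hL : 0 ≤ L) :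
    IntegrableOn (fun u : ℝ => Real.exp (2 * y * u - κ ^ 2 / 2 * expRem (2 * u / κ))) (Ioi L) := by
  have h0 := (integrableOn_gaussMoment 0 (-y)).mono_set (Ioi_subset_Ioi hL)
  refine h0.mono' (by unfold expRem; fun_prop) ?_
  filter_upwards [ae_restrict_mem measurableSet_Ioi] with u hu
  have hu0 : 0 < u := lt_of_le_of_lt hL hu
  rw [Real.norm_of_nonneg (Real.exp_pos _).le, pow_zero, one_mul]
  refine Real.exp_le_exp.2 ?_
  have h2 : u ^ 2 ≤ κ ^ 2 / 2 * expRem (2 * u / κ) := by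
    have := mul_le_mul_of_nonneg_left (sq_le_expRem (v := 2 * u / κ) (by positivity))
      (show 0 ≤ κ ^ 2 / 2 by positivity)
    refine le_trans (le_of_eq ?_) this
    field_simp
  linarith

theorem integrableOn_Iic_of_innerMass {κ y : ℝ} (hκ : 0 < κ) (hy : -(κ / 2) < y) :
    IntegrableOn (fun u : ℝ => Real.exp (2 * y * u - κ ^ 2 / 2 * expRem (2 * u / κ))) (Iic 0) := by
  have h := Iff.mpr integrableOn_Ici_iff_integrableOn_Ioi (integrableOn_innerMass hκ hy)
  rw [← neg_zero] at h
  have h2 := h.comp_neg_Iic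
  refine h2.congr_fun (fun u _ => ?_) measurableSet_Iic
  simp only [innerPhase]
  congr 2
  · ring
  · congr 2; ring

theorem integral_off_gap {κ L y : ℝ} (hκ : 0 < κ) (hL : 0 < L) (hy : -(κ / 2) < y) :
    ∫ u in (Ioo 0 L)ᶜ, Real.exp (2 * y * u - κ ^ 2 / 2 * expRem (2 * u / κ)) =
      innerMass κ y + outerMass κ L y := by
  have h1 : (Ioo 0 L)ᶜ = Iic 0 ∪ Ici L := by
    ext u
    simp only [mem_compl_iff, mem_Ioo, mem_union, mem_Iic, mem_Ici, not_and_or, not_lt]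
  have hdisj : Disjoint (Iic 0) (Ici L) := by
    rw [Set.disjoint_left]
    intro u hu hu'
    exact absurd (lt_of_lt_of_le hL hu') (not_lt.2 hu)
  rw [h1, setIntegral_union hdisj measurableSet_Ici (integrableOn_Iic_of_innerMass hκ hy)
    (Iff.mpr integrableOn_Ici_iff_integrableOn_Ioi (integrableOn_outerMass y hκ hL.le)),
    integral_Ici_eq_integral_Ioi, ← innerMass_eq_integral_Iic, outerMass]

/-- The substitution `r = r₁ e^{u / m}` in an integral over the positive half-line. -/
theorem integral_Ioi_eq_integral_exp {r₁ m : ℝ} (hr₁ : 0 < r₁) (hm : 0 < m) (F : ℝ → ℝ) :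
    ∫ r in Ioi (0 : ℝ), F r =
      ∫ u : ℝ, r₁ * Real.exp (u / m) / m * F (r₁ * Real.exp (u / m)) := by
  have himg : (fun u : ℝ => r₁ * Real.exp (u / m)) '' univ = Ioi 0 := by
    ext r
    simp only [mem_image, mem_univ, true_and, mem_Ioi]
    constructor
    · rintro ⟨u, rfl⟩; positivity
    · intro hr
      refine ⟨m * Real.log (r / r₁), ?_⟩
      rw [mul_div_cancel_left₀ _ hm.ne', Real.exp_log (by positivity)]
      field_simp
  have hinj : InjOn (fun u : ℝ => r₁ * Real.exp (u / m)) univ := by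
    intro u _ v _ huv
    have h1 := Real.exp_injective (mul_left_cancel₀ hr₁.ne' huv)
    field_simp at h1
    exact h1
  have h := integral_image_eq_integral_abs_deriv_smul (s := univ)
    (f := fun u : ℝ => r₁ * Real.exp (u / m)) (f' := fun u => r₁ * Real.exp (u / m) / m)
    MeasurableSet.univ (fun u _ => ?_) hinj F
  · rw [himg, setIntegral_univ] at h
    rw [h]
    refine integral_congr_ae (Eventually.of_forall fun u => ?_)
    simp only [smul_eq_mul]
    rw [abs_of_pos (by positivity)]
  · have := (((hasDerivAt_id u).div_const m).exp.const_mul r₁)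
    refine (this.congr_deriv ?_).hasDerivWithinAt
    simp only [id]
    ring

theorem monomialNormSq_eq_integral_Ioi (b α r₁ r₂ : ℝ) {n : ℕ} (hn : 0 < n) (k : ℕ) :
    monomialNormSq b α r₁ r₂ n k = 2 * ∫ r in Ioi (0 : ℝ),
      (Ioo r₁ r₂)ᶜ.indicator
        (fun r => r ^ (2 * (k + α) + 1) * Real.exp (-(n * r ^ (2 * b)))) r := by
  have h1 : ∫ z : ℂ, ‖z ^ k * (halfWeight b α r₁ r₂ n z : ℂ)‖ ^ 2 = ∫ z : ℂ,
      (fun r : ℝ => (Ioo r₁ r₂)ᶜ.indicator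
        (fun r => r ^ (2 * (k + α)) * Real.exp (-(n * r ^ (2 * b)))) r) ‖z‖ := by
    refine integral_congr_ae ?_
    have h0 : ∀ᵐ z : ℂ, z ≠ 0 := by simp [ae_iff]
    filter_upwards [h0] with z hz
    have hz' : 0 < ‖z‖ := norm_pos_iff.2 hz
    by_cases h : ‖z‖ ∈ Ioo r₁ r₂
    · rw [halfWeight_gap hn h, indicator_of_notMem (by simpa using h)]
      simp
    · rw [halfWeight_off_gap hn hz h, indicator_of_mem (by exact h), norm_mul, norm_pow,
        Complex.norm_real, Real.norm_of_nonneg (by positivity), mul_pow, mul_pow,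
        ← Real.exp_nat_mul, ← Real.rpow_natCast, ← Real.rpow_natCast, ← Real.rpow_natCast,
        ← Real.rpow_mul hz'.le, ← Real.rpow_mul hz'.le, ← mul_assoc, ← Real.rpow_add hz']
      congr 2
      · push_cast; ring
      · push_cast; ring
  rw [monomialNormSq, h1, integral_fun_norm_addHaar (volume : Measure ℂ)]
  have hvol : (volume : Measure ℂ).real (Metric.ball 0 1) = π := by
    rw [Measure.real, Complex.volume_ball]
    simp
  rw [hvol, Complex.finrank_real_complex, nsmul_eq_mul, smul_eq_mul]
  have h2 : ∫ y in Ioi (0 : ℝ), y ^ (2 - 1) • (Ioo r₁ r₂)ᶜ.indicator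
        (fun r => r ^ (2 * (k + α)) * Real.exp (-(n * r ^ (2 * b)))) y
      = ∫ r in Ioi (0 : ℝ), (Ioo r₁ r₂)ᶜ.indicator
        (fun r => r ^ (2 * (k + α) + 1) * Real.exp (-(n * r ^ (2 * b)))) r := by
    refine setIntegral_congr_fun measurableSet_Ioi fun r hr => ?_
    have hr : 0 < r := hr
    simp only [indicator]
    split_ifs
    · rw [Real.rpow_add_one hr.ne', smul_eq_mul]
      norm_num
      ring
    · simp
  rw [h2]
  have := Real.pi_pos
  push_cast
  field_simp

/-- The position of the `k`-th monomial in the rescaled variable of the edge. -/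
def edgeIndex (b α κ : ℝ) (k : ℕ) : ℝ := ((k + 1 + α) / b - κ ^ 2 / 2) / κ

/-- In the variable r = r₁e^{u/(bκ)} the weight is exp(−(κ²/2)e^{2u/κ}), and its linear part −κu
cancels against the power of r up to 2yu. The gap becomes 0 < u < κb log(r₂/r₁), so
`integral_off_gap` applies. -/
theorem monomialNormSq_eq {b α r₁ r₂ κ : ℝ} {n : ℕ} (hb : 0 < b) (hα : -1 < α) (hr₁ : 0 < r₁)
    (hr₁₂ : r₁ < r₂) (hn : 0 < n) (hκ : 0 < κ) (hκn : κ ^ 2 = 2 * (n * r₁ ^ (2 * b))) (k : ℕ) :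
    monomialNormSq b α r₁ r₂ n k = 2 / (b * κ) * r₁ ^ (2 * (k + 1 + α)) * Real.exp (-(κ ^ 2 / 2)) *
      (innerMass κ (edgeIndex b α κ k)
        + outerMass κ (κ * (b * Real.log (r₂ / r₁))) (edgeIndex b α κ k)) := by
  have hbκ : 0 < b * κ := by positivity
  have hlog : 0 < Real.log (r₂ / r₁) := Real.log_pos (by rwa [one_lt_div hr₁])
  set y := edgeIndex b α κ k with hy
  set L := κ * (b * Real.log (r₂ / r₁)) with hL
  have hL0 : 0 < L := mul_pos hκ (mul_pos hb hlog)
  have hya : (k + 1 + α) / b = κ ^ 2 / 2 + κ * y := by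
    rw [hy, edgeIndex]; field_simp; ring
  have hy2 : -(κ / 2) < y := by
    have h1 : 0 < (k + 1 + α) / b := by
      have : (0 : ℝ) ≤ k := by positivity
      apply div_pos _ hb; linarith
    rw [hya] at h1
    have h2 : 0 < κ * (κ / 2 + y) := by linarith
    have := pos_of_mul_pos_right h2 hκ.le
    linarith
  have hgap : ∀ u : ℝ, r₁ * Real.exp (u / (b * κ)) ∈ (Ioo r₁ r₂)ᶜ ↔ u ∈ (Ioo 0 L)ᶜ := by
    intro u
    rw [mem_compl_iff, mem_compl_iff, not_iff_not, mem_Ioo, mem_Ioo]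
    refine and_congr ?_ ?_
    · rw [lt_mul_iff_one_lt_right hr₁, Real.one_lt_exp_iff]
      exact ⟨fun h => by rwa [lt_div_iff₀ hbκ, zero_mul] at h, fun h => by positivity⟩
    · rw [mul_comm, ← lt_div_iff₀ hr₁, ← Real.lt_log_iff_exp_lt (div_pos (hr₁.trans hr₁₂) hr₁),
        div_lt_iff₀ hbκ, hL]
      ring_nf
  rw [monomialNormSq_eq_integral_Ioi b α r₁ r₂ hn k, integral_Ioi_eq_integral_exp hr₁ hbκ,
    ← integral_off_gap hκ hL0 hy2, ← integral_indicator (measurableSet_Ioo.compl),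
    ← integral_const_mul, ← integral_const_mul]
  refine integral_congr_ae (Eventually.of_forall fun u => ?_)
  beta_reduce
  by_cases hu : u ∈ (Ioo 0 L)ᶜ
  · rw [indicator_of_mem hu, indicator_of_mem ((hgap u).2 hu)]
    have he : 0 < Real.exp (u / (b * κ)) := Real.exp_pos _
    have e1 : (r₁ * Real.exp (u / (b * κ))) ^ (2 * (k + α) + 1) * (r₁ * Real.exp (u / (b * κ)))
        = r₁ ^ (2 * (k + 1 + α)) * Real.exp ((κ + 2 * y) * u) := by
      rw [← Real.rpow_add_one (by positivity), Real.mul_rpow hr₁.le he.le, ← Real.exp_mul]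
      congr 2
      · ring
      · have : κ + 2 * y = 2 * ((k + 1 + α) / b) / κ := by rw [hya]; field_simp
        rw [this]; field_simp; ring
    have e2 : n * (r₁ * Real.exp (u / (b * κ))) ^ (2 * b) = κ ^ 2 / 2 * Real.exp (2 * u / κ) := by
      rw [Real.mul_rpow hr₁.le he.le, ← Real.exp_mul, hκn,
        show u / (b * κ) * (2 * b) = 2 * u / κ by field_simp]
      ring
    rw [e2]
    have e3 : Real.exp ((κ + 2 * y) * u) * Real.exp (-(κ ^ 2 / 2 * Real.exp (2 * u / κ)))
        = Real.exp (-(κ ^ 2 / 2)) * Real.exp (2 * y * u - κ ^ 2 / 2 * expRem (2 * u / κ)) := by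
      rw [← Real.exp_add, ← Real.exp_add, expRem]
      congr 1
      field_simp
      ring
    calc _ = 2 / (b * κ) * ((r₁ * Real.exp (u / (b * κ))) ^ (2 * (k + α) + 1) *
          (r₁ * Real.exp (u / (b * κ)))) * Real.exp (-(κ ^ 2 / 2 * Real.exp (2 * u / κ))) := by
          ring
      _ = 2 / (b * κ) * r₁ ^ (2 * (k + 1 + α)) * (Real.exp ((κ + 2 * y) * u) *
          Real.exp (-(κ ^ 2 / 2 * Real.exp (2 * u / κ)))) := by rw [e1]; ring
      _ = _ := by rw [e3]; ring
  · rw [indicator_of_notMem hu, indicator_of_notMem (fun h => hu ((hgap u).1 h))]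
    simp

theorem mul_exp_neg_edgeShift {b κ s r₁ : ℝ} (hbκ : 0 < b * κ) (hs : s < b * κ) :
    r₁ * (1 - s / (b * κ)) = r₁ * Real.exp (-(edgeShift b κ s / (b * κ))) := by
  have h1 : 0 < 1 - s / (b * κ) := by
    rw [sub_pos, div_lt_one hbκ]; exact hs
  have h2 : -(edgeShift b κ s / (b * κ)) = Real.log (1 - s / (b * κ)) := by
    rw [edgeShift, neg_div, neg_neg, mul_div_cancel_left₀ _ hbκ.ne']
  rw [h2, Real.exp_log h1]

/-- The index y is built from k+1+α, the 1 coming from the area element in the norm, whereas a point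
contributes k+α. This mismatch is the summand u/(bκ) of `edgePhase`. -/
theorem halfWeight_mul_pow {b α r₁ r₂ κ s : ℝ} {n : ℕ} {z : ℂ} (hb : 0 < b)
    (hr₁ : 0 < r₁) (hn : 0 < n) (hκ : 0 < κ) (hκn : κ ^ 2 = 2 * (n * r₁ ^ (2 * b)))
    (hs : 0 < s) (hsκ : s < b * κ) (hz : ‖z‖ = r₁ * (1 - s / (b * κ))) (k : ℕ) :
    halfWeight b α r₁ r₂ n z * (r₁ * (1 - s / (b * κ))) ^ k =
      r₁ ^ (k + α) * Real.exp (edgePhase b κ s (edgeIndex b α κ k) - κ ^ 2 / 4) := by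
  have hbκ : 0 < b * κ := by positivity
  have hδ : 0 < s / (b * κ) := by positivity
  have hlt : r₁ * (1 - s / (b * κ)) < r₁ := by nlinarith
  have hr := mul_exp_neg_edgeShift (r₁ := r₁) hbκ hsκ
  have hz0 : z ≠ 0 := by
    rw [← norm_pos_iff, hz, hr]; positivity
  rw [halfWeight_off_gap hn hz0 (by rw [hz]; exact fun h => by linarith [h.1]), hz, hr]
  set y := edgeIndex b α κ k with hy
  set u := edgeShift b κ s with hu
  set e := Real.exp (-(u / (b * κ))) with he
  have he0 : 0 < e := Real.exp_pos _
  have hya : (k + α) / b = κ ^ 2 / 2 + κ * y - 1 / b := by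
    rw [hy, edgeIndex]; field_simp; ring
  have e1 : (r₁ * e) ^ α * (r₁ * e) ^ k = r₁ ^ (k + α)
      * Real.exp (u / (b * κ) - y * u - κ * u / 2) := by
    rw [← Real.rpow_natCast, ← Real.rpow_add (by positivity), Real.mul_rpow hr₁.le he0.le, he,
      ← Real.exp_mul, add_comm α]
    congr 2
    have : -(u / (b * κ)) * (k + α) = -(u / κ) * ((k + α) / b) := by field_simp
    rw [this, hya]
    field_simp
    ring
  have e2 : n / 2 * (r₁ * e) ^ (2 * b) = κ ^ 2 / 4 * Real.exp (-(2 * u / κ)) := by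
    rw [Real.mul_rpow hr₁.le he0.le, he, ← Real.exp_mul, hκn,
      show -(u / (b * κ)) * (2 * b) = -(2 * u / κ) by field_simp]
    ring
  rw [mul_right_comm, e1, e2, mul_assoc, ← Real.exp_add]
  congr 2
  rw [edgePhase, ← hu, innerPhase, expRem]
  field_simp
  ring

theorem norm_edgePoint {b r₁ β s κ : ℝ} {n : ℕ} (hr₁ : 0 < r₁) (hκ : κ = r₁ ^ b * √(2 * n))
    (hbκ : 0 < b * κ) (hsκ : s < b * κ) :
    ‖edgePoint b r₁ β s n‖ = r₁ * (1 - s / (b * κ)) := by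
  have hr := mul_exp_neg_edgeShift (r₁ := r₁) hbκ hsκ
  have hpos : 0 < r₁ * (1 - s / (b * κ)) := by rw [hr]; positivity
  rw [edgePoint, mul_assoc b, ← hκ, norm_mul, Complex.norm_real, Real.norm_of_nonneg hpos.le,
    mul_comm Complex.I, Complex.norm_exp_ofReal_mul_I, mul_one]

theorem edgePoint_mul_conj {b r₁ β s₁ s₂ κ : ℝ} {n : ℕ} (hκ : κ = r₁ ^ b * √(2 * n)) :
    edgePoint b r₁ β s₁ n * starRingEnd ℂ (edgePoint b r₁ β s₂ n) =
      ((r₁ * (1 - s₁ / (b * κ)) * (r₁ * (1 - s₂ / (b * κ))) : ℝ) : ℂ) := by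
  have h : Complex.exp (Complex.I * β) * starRingEnd ℂ (Complex.exp (Complex.I * β)) = 1 := by
    rw [Complex.mul_conj', mul_comm, Complex.norm_exp_ofReal_mul_I]
    simp
  simp only [edgePoint, mul_assoc b, ← hκ, map_mul, Complex.conj_ofReal]
  rw [Complex.ofReal_mul (r₁ * (1 - s₁ / (b * κ)))]
  linear_combination ((r₁ * (1 - s₁ / (b * κ)) : ℝ) : ℂ) * ((r₁ * (1 - s₂ / (b * κ)) : ℝ) : ℂ) * h

/-- The factors e^{−κ²/4} of the two points cancel e^{−κ²/2} in the norm, and all powers of r₁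
cancel except r₁⁻². -/
theorem kernel_edgePoint {b α r₁ r₂ s₁ s₂ β κ : ℝ} {n : ℕ} (hb : 0 < b) (hα : -1 < α)
    (hr₁ : 0 < r₁) (hr₁₂ : r₁ < r₂) (hs₁ : 0 < s₁) (hs₂ : 0 < s₂) (hn : 0 < n)
    (hκ : κ = r₁ ^ b * √(2 * n)) (hsκ₁ : s₁ < b * κ) (hsκ₂ : s₂ < b * κ) :
    kernel b α r₁ r₂ n (edgePoint b r₁ β s₁ n) (edgePoint b r₁ β s₂ n) =
      ((1 / r₁ ^ 2 * (b * κ / 2 * ∑ k ∈ Finset.range n,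
        (Real.exp (edgePhase b κ s₁ (edgeIndex b α κ k) + edgePhase b κ s₂ (edgeIndex b α κ k))
          / (innerMass κ (edgeIndex b α κ k)
            + outerMass κ (κ * (b * Real.log (r₂ / r₁))) (edgeIndex b α κ k)))) : ℝ) : ℂ) := by
  have hn' : (0 : ℝ) < n := by exact_mod_cast hn
  have hκ0 : 0 < κ := by rw [hκ]; positivity
  have hbκ : 0 < b * κ := by positivity
  have hκn : κ ^ 2 = 2 * (n * r₁ ^ (2 * b)) := by
    rw [hκ, mul_pow, Real.sq_sqrt (by positivity), mul_comm 2 b, Real.rpow_mul hr₁.le]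
    norm_num
    ring
  have hz₁ := norm_edgePoint (β := β) hr₁ hκ hbκ hsκ₁
  have hz₂ := norm_edgePoint (β := β) hr₁ hκ hbκ hsκ₂
  rw [kernel]
  simp only [← mul_pow, edgePoint_mul_conj hκ]
  rw [Finset.mul_sum, Finset.mul_sum, Finset.mul_sum, Complex.ofReal_sum]
  refine Finset.sum_congr rfl fun k _ => ?_
  rw [← Complex.ofReal_pow, ← Complex.ofReal_div, ← Complex.ofReal_mul, ← Complex.ofReal_mul]
  congr 1
  have h₁ := halfWeight_mul_pow (α := α) (r₂ := r₂) hb hr₁ hn hκ0 hκn hs₁ hsκ₁ hz₁ k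
  have h₂ := halfWeight_mul_pow (α := α) (r₂ := r₂) hb hr₁ hn hκ0 hκn hs₂ hsκ₂ hz₂ k
  set y := edgeIndex b α κ k with hy
  have hW := monomialNormSq_eq hb hα hr₁ hr₁₂ hn hκ0 hκn k
  rw [← hy] at hW
  have hpos := monomialNormSq_pos (r₂ := r₂) hb hα hr₁ hn k
  have hmass : innerMass κ y + outerMass κ (κ * (b * Real.log (r₂ / r₁))) y ≠ 0 := by
    intro h0
    rw [h0, mul_zero] at hW
    exact hpos.ne' hW
  have hpow : r₁ ^ (2 * (k + 1 + α)) = r₁ ^ (k + α) * r₁ ^ (k + α) * r₁ ^ 2 := by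
    rw [← Real.rpow_add hr₁, ← Real.rpow_natCast r₁ 2, ← Real.rpow_add hr₁]
    congr 1; push_cast; ring
  have hexp : Real.exp (edgePhase b κ s₁ y - κ ^ 2 / 4) * Real.exp (edgePhase b κ s₂ y - κ ^ 2 / 4)
      = Real.exp (edgePhase b κ s₁ y + edgePhase b κ s₂ y) * Real.exp (-(κ ^ 2 / 2)) := by
    rw [← Real.exp_add, ← Real.exp_add]; congr 1; ring
  have hnum : halfWeight b α r₁ r₂ n (edgePoint b r₁ β s₁ n)
      * halfWeight b α r₁ r₂ n (edgePoint b r₁ β s₂ n)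
      * (r₁ * (1 - s₁ / (b * κ)) * (r₁ * (1 - s₂ / (b * κ)))) ^ k
      = r₁ ^ (k + α) * r₁ ^ (k + α)
        * (Real.exp (edgePhase b κ s₁ y + edgePhase b κ s₂ y) * Real.exp (-(κ ^ 2 / 2))) := by
    rw [← hexp, mul_pow, mul_mul_mul_comm, h₁, h₂]; ring
  rw [mul_div_assoc', hnum, hW, hpow]
  have hA : r₁ ^ (k + α) ≠ 0 := (Real.rpow_pos_of_pos hr₁ _).ne'
  have hE : Real.exp (-(κ ^ 2 / 2)) ≠ 0 := (Real.exp_pos _).ne'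
  field_simp

theorem edgeIndex_eq {b α κ : ℝ} (hb : 0 < b) (hκ : 0 < κ) (k : ℕ) :
    edgeIndex b α κ k = edgeIndex b α κ 0 + k * (1 / (b * κ)) := by
  rw [edgeIndex, edgeIndex]; field_simp; push_cast; ring

/-- The transition y = 0 occurs at k+1+α = n·b·r₁^{2b}. The inequality places it strictly below n,
so the grid extends a distance of order κ to the right of 0. -/
theorem mul_rpow_lt_one {b r₁ r₂ : ℝ} (hb : 0 < b) (hr₁ : 0 < r₁) (hr₁₂ : r₁ < r₂)
    (hr₂ : r₂ < b ^ (-(1 / (2 * b)))) : b * r₁ ^ (2 * b) < 1 := by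
  have h1 : r₁ ^ (2 * b) < (b ^ (-(1 / (2 * b)))) ^ (2 * b) :=
    Real.rpow_lt_rpow hr₁.le (hr₁₂.trans hr₂) (by positivity)
  rw [← Real.rpow_mul hb.le, show -(1 / (2 * b)) * (2 * b) = -1 by field_simp, Real.rpow_neg_one]
    at h1
  calc b * r₁ ^ (2 * b) < b * b⁻¹ := by gcongr
    _ = 1 := mul_inv_cancel₀ hb.ne'

end HardWall

end

/-! ### Assembly of the asymptotic expansion. -/

theorem theorem2 (b α r₁ r₂ s₁ s₂ β : ℝ) (hb : 0 < b) (hα : -1 < α)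
    (hr₁ : 0 < r₁) (hr₁₂ : r₁ < r₂) (hr₂ : r₂ < b ^ (-(1 / (2 * b))))
    (hs₁ : 0 < s₁) (hs₂ : 0 < s₂) :
    Integrable (fun y : ℝ => HardWall.profile s₁ s₂ y) ∧
    Integrable (fun y : ℝ => HardWall.profile s₁ s₂ y * HardWall.correction b s₁ s₂ y) ∧
    (fun n : ℕ =>
      HardWall.kernel b α r₁ r₂ n (HardWall.edgePoint b r₁ β s₁ n) (HardWall.edgePoint b r₁ β s₂ n)
        - ((HardWall.coeffOne b r₁ s₁ s₂ * n + HardWall.coeffTwo b r₁ s₁ s₂ * √(n : ℝ) : ℝ) : ℂ))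
      =O[atTop] (fun _ : ℕ => (1 : ℝ)) := by
  have hσ : 0 < s₁ + s₂ := by positivity
  refine ⟨HardWall.integrable_profile hσ, HardWall.integrable_profile_mul_correction hb hσ, ?_⟩
  have hlog : 0 < Real.log (r₂ / r₁) := Real.log_pos (by rwa [one_lt_div hr₁])
  set ρ := r₁ ^ (2 * b) with hρ
  have hρ0 : 0 < ρ := Real.rpow_pos_of_pos hr₁ _
  have hbρ : b * ρ < 1 := HardWall.mul_rpow_lt_one hb hr₁ hr₁₂ hr₂
  have hbρ0 : 0 < b * ρ := by positivity
  -- The right end of the grid lies near dκ: the n steps cover n/(bκ) = κ/(2bρ), starting near −κ/2.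
  set d := 1 / (2 * (b * ρ)) - 1 / 2 with hd
  have hd0 : 0 < d := by
    rw [hd, sub_pos, one_div_lt_one_div two_pos (by positivity)]
    linarith
  -- Half of each available distance, κ/2 on the left and dκ on the right; the other half absorbs
  -- the offset (1+α)/(bκ) and the half cell.
  set c₁ := min (1 / 4) (d / 2) with hc₁
  have hc₁0 : 0 < c₁ := by positivity
  obtain ⟨C, κ₀, hκ₀, hsum⟩ := HardWall.exists_sum_asymptotics (l := b * Real.log (r₂ / r₁))
    hb hs₁ hs₂ (by positivity) hc₁0
  set κ : ℕ → ℝ := fun n => r₁ ^ b * √(2 * n) with hκdef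
  have hκlim : Tendsto κ atTop atTop := by
    refine Tendsto.const_mul_atTop (Real.rpow_pos_of_pos hr₁ b) ?_
    refine Real.tendsto_sqrt_atTop.comp ?_
    exact Tendsto.const_mul_atTop two_pos tendsto_natCast_atTop_atTop
  refine Asymptotics.IsBigO.of_bound (1 / r₁ ^ 2 * C) ?_
  -- The bounds s_i/b keep 1 − s_i/(bκ) positive, so the points have modulus r₁(1 − s_i/(bκ)). The
  -- last two give the left and right reach of the grid.
  filter_upwards [eventually_gt_atTop 0, hκlim.eventually_ge_atTop κ₀,
    hκlim.eventually_gt_atTop (s₁ / b), hκlim.eventually_gt_atTop (s₂ / b),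
    hκlim.eventually_ge_atTop (4 * ((1 + |α|) / b)), hκlim.eventually_ge_atTop (1 / (b * d))]
    with n hn hκ1 hκs₁ hκs₂ hκ2 hκ3
  have hn' : (0 : ℝ) < n := by exact_mod_cast hn
  have hκ0 : 0 < κ n := by linarith
  have hκeq : κ n = r₁ ^ b * √(2 * n) := rfl
  have hκn : κ n ^ 2 = 2 * (n * ρ) := by
    rw [hκeq, mul_pow, Real.sq_sqrt (by positivity), hρ, mul_comm 2 b, Real.rpow_mul hr₁.le]
    norm_num
    ring
  have hy0 : HardWall.edgeIndex b α (κ n) 0 = (1 + α) / b / κ n - κ n / 2 := by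
    rw [HardWall.edgeIndex]; field_simp; push_cast; ring
  have hα' : 0 < (1 + α) / b := div_pos (by linarith) hb
  have hbκ : 0 < b * κ n := by positivity
  have hker := HardWall.kernel_edgePoint (β := β) hb hα hr₁ hr₁₂ hs₁ hs₂ hn hκeq
    (by rw [div_lt_iff₀ hb] at hκs₁; linarith)
    (by rw [div_lt_iff₀ hb] at hκs₂; linarith)
  have hA : HardWall.edgeIndex b α (κ n) 0 - 1 / (b * κ n) / 2 ≤ -(c₁ * κ n) := by
    have h1 : (1 + α) / b / κ n ≤ κ n / 4 := by
      rw [div_le_iff₀ hκ0]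
      have h2 : (1 + α) / b ≤ (1 + |α|) / b := by gcongr; exact le_abs_self α
      nlinarith
    have h3 : c₁ * κ n ≤ 1 / 4 * κ n := by gcongr; exact min_le_left _ _
    have h4 : 0 < 1 / (b * κ n) / 2 := by positivity
    rw [hy0]; linarith
  have hB : c₁ * κ n ≤ HardWall.edgeIndex b α (κ n) 0 - 1 / (b * κ n) / 2
      + n * (1 / (b * κ n)) := by
    have h1 : n * (1 / (b * κ n)) = (d + 1 / 2) * κ n := by
      have : (n : ℝ) = κ n ^ 2 / (2 * ρ) := by rw [hκn]; field_simp
      rw [hd]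
      rw [mul_one_div, div_eq_iff hbκ.ne']
      rw [this]
      field_simp
      ring
    have h2 : 1 / (b * κ n) / 2 ≤ d / 2 * κ n := by
      rw [div_le_iff₀ (by positivity)] at hκ3
      rw [div_div, div_le_iff₀ (by positivity)]
      have h5 : 1 ≤ κ n := hκ₀.trans hκ1
      have h6 : κ n * (b * d) ≤ κ n * (b * d) * κ n := le_mul_of_one_le_right (by positivity) h5
      nlinarith
    have h3 : c₁ * κ n ≤ d / 2 * κ n := by gcongr; exact min_le_right _ _
    have h4 : 0 < (1 + α) / b / κ n := by positivity
    rw [h1, hy0]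
    nlinarith
  have hmain := hsum (κ n) (HardWall.edgeIndex b α (κ n) 0) n hκ1
    (by rw [hy0]; have : 0 < (1 + α) / b / κ n := by positivity
        linarith) hA hB
  simp only [← HardWall.edgeIndex_eq hb hκ0] at hmain
  -- Matching of scales: twice the inner Laplacian times n is b²κ²/r₁², and its square root is
  -- bκ/r₁.
  have hcoeff : HardWall.coeffOne b r₁ s₁ s₂ * n + HardWall.coeffTwo b r₁ s₁ s₂ * √(n : ℝ)
      = 1 / r₁ ^ 2 * (b ^ 2 * κ n ^ 2 * (∫ y, HardWall.profile s₁ s₂ y)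
        + b ^ 2 * κ n * ∫ y, HardWall.profile s₁ s₂ y * HardWall.termCorrection b s₁ s₂ y) := by
    have h1 : r₁ ^ (2 * b - 2) = ρ / r₁ ^ 2 := by
      rw [Real.rpow_sub hr₁, hρ]; norm_num
    have h2 : √(2 * HardWall.innerLaplacian b r₁) * √(n : ℝ) = b * κ n / r₁ := by
      rw [← Real.sqrt_mul' _ hn'.le, Real.sqrt_eq_iff_mul_self_eq_of_pos (by positivity),
        HardWall.innerLaplacian, h1]
      have : b * κ n / r₁ * (b * κ n / r₁) = b ^ 2 * κ n ^ 2 / r₁ ^ 2 := by field_simp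
      rw [this, hκn]
      ring
    rw [HardWall.coeffOne, HardWall.coeffTwo, HardWall.integral_profile_mul_correction hb hσ, hκn]
    have h3 : b * √(2 * HardWall.innerLaplacian b r₁) / r₁
        * (∫ y, HardWall.profile s₁ s₂ y * HardWall.termCorrection b s₁ s₂ y) * √(n : ℝ)
        = b / r₁ * (√(2 * HardWall.innerLaplacian b r₁) * √(n : ℝ))
          * ∫ y, HardWall.profile s₁ s₂ y * HardWall.termCorrection b s₁ s₂ y := by ring
    rw [h3, h2, HardWall.innerLaplacian, h1]
    field_simp
  rw [hker, hcoeff, ← Complex.ofReal_sub, Complex.norm_real, ← mul_sub, norm_mul, norm_one, mul_one,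
    Real.norm_of_nonneg (by positivity)]
  gcongr
  exact hmain
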